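/- **Conventions.** A symmetric monoidal model category is a closed symmetric monoidal category $(\mathcal V,\otimes,\mathbb 1)$ with a model structure satisfying the pushout-product axiom and the unit axiom (for $x$ cofibrant and any cofibrant replacement $q\colon Q\mathbb 1\to\mathbb 1$, the map $x\otimes Q\mathbb 1\to x\otimes\mathbb 1\cong x$ is a weak equivalence); $[-,-]$ is its internal hom. For a $\mathcal V$-category $\mathcal C$ with hom objects $\underline{\mathcal C}(x,y)$ and a model structure on its underlying category, consider the following notions. * *SM7*: for a cofibration $i\colon a\to b$ and a fibration $p\colon x\to y$, the map $\underline{\mathcal C}(b,x)\to\underline{\mathcal C}(a,x)\times_{\underline{\mathcal C}(a,y)}\underline{\mathcal C}(b,y)$ is a fibration in $\mathcal V$, acyclic if $i$ or $p$ is. * A *weak tensoring* is a bifunctor $\otimes\colon\mathcal C\times\mathcal V\to\mathcal C$ satisfying the external pushout-product axiom and such that $x\otimes v$ is cofibrant when $x$ and $v$ are, with maps $\varphi_{v,x,y}\colon\underline{\mathcal C}(x\otimes v,y)\to[v,\underline{\mathcal C}(x,y)]$ in $\mathcal V$, natural in $v,x,y$, which are weak equivalences for $v,x$ cofibrant and $y$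 fibrant, and natural maps $\rho_x\colon x\otimes\mathbb 1\to x$ such that $\varphi_{\mathbb 1,x,y}\circ\rho_x^*$ is the canonical isomorphism $\underline{\mathcal C}(x,y)\cong[\mathbb 1,\underline{\mathcal C}(x,y)]$. It is *set-compatible* if $\mathcal V(\mathbb 1,\varphi_{v,x,y})$ is a bijection for all $v,x,y$, and *unital* if all $\rho_x$ are isomorphisms. * A *weak cotensoring* is a bifunctor $(y,v)\mapsto y^v$, $\mathcal C\times\mathcal V^{\mathrm{op}}\to\mathcal C$, satisfying the external pullback-power axiom and such that $y^v$ is fibrant when $y$ is fibrant and $v$ cofibrant, with natural maps $\psi_{v,x,y}\colon\underline{\mathcal C}(x,y^v)\to[v,\underline{\mathcal C}(x,y)]$, which are weak equivalences for $v,x$ cofibrant and $y$ fibrant, and natural maps $\eta_y\colon y\to y^{\mathbb 1}$ such that $\psi_{\mathbb 1,x,y}\circ(\eta_y)_*$ is the canonical isomorphism. *Set-compatible* (for $\psi$) and *unital* (for $\eta$) are defined likewise. * $\mathcal C$ is a *weak $\mathcal V$-model category* if it satisfies SM7, $\underline{\mathcal C}(x,y)$ is fibrant for $x$ cofibrant and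 $y$ fibrant, it has a weak tensoring and a weak cotensoring over $\mathcal V$, and, for $x$ cofibrant and $y$ fibrant, the canonical map $[x,y]\to[\mathbb 1,\underline{\mathcal C}(x,y)]$ from the hom-set in $\mathrm{Ho}(\mathcal C)$ to the one in $\mathrm{Ho}(\mathcal V)$ is a bijection ($\pi_0$ of mapping space axiom). * $\mathcal C$ is a *$\mathcal V$-model category* if it is tensored and cotensored over $\mathcal V$ (isomorphisms $\underline{\mathcal C}(x\otimes v,y)\cong[v,\underline{\mathcal C}(x,y)]\cong\underline{\mathcal C}(x,y^v)$, the first $\mathcal V$-natural in $y$, the second $\mathcal V$-natural in $x$) and satisfies the external pushout-product axiom and the external unit axiom (for $x$ cofibrant and any cofibrant replacement $q\colon Q\mathbb 1\to\mathbb 1$, the map $x\otimes Q\mathbb 1\to x\otimes\mathbb 1\cong x$ is a weak equivalence). **Theorem.** Let $\mathcal V$ and $\mathcal W$ be symmetric monoidal model categories and $F\colon\mathcal W\rightleftarrows\mathcal V\colon G$ a weak monoidal Quillen adjunction: a Quillen adjunction $F\dashv G$ with a lax monoidal structure on $G$ such that, for the corresponding oplax monoidal structure $(\delta,\varepsilon)$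 on $F$, the map $\delta_{x,y}\colon F(x\otimes y)\to Fx\otimes Fy$ is a weak equivalence for all cofibrant $x,y\in\mathcal W$, and $F(Q\mathbb 1_{\mathcal W})\to F(\mathbb 1_{\mathcal W})\xrightarrow{\varepsilon}\mathbb 1_{\mathcal V}$ is a weak equivalence for some cofibrant replacement $Q\mathbb 1_{\mathcal W}\to\mathbb 1_{\mathcal W}$. Suppose that $\varepsilon$ is an isomorphism. Let $\mathcal C$ be a $\mathcal V$-category with a model structure on its underlying category, and let $G_*\mathcal C$ be the $\mathcal W$-category with the same objects and hom objects $G\,\underline{\mathcal C}(x,y)$; as $\varepsilon$ is an isomorphism, it has the same underlying category as $\mathcal C$, and it is given the same model structure. 1. If $\mathcal C$ is a weak $\mathcal V$-model category, then $G_*\mathcal C$ is a weak $\mathcal W$-model category, with the weak tensoring $x\otimes w:=x\otimes Fw$ and the weak cotensoring $y^w:=y^{Fw}$, whose structure maps are the composites $$G\,\underline{\mathcal C}(x\otimes Fw,y)\xrightarrow{G\varphi}G[Fw,\underline{\mathcal C}(x,y)]\to[w,G\,\underline{\mathcal C}(x,y)],\qquad x\otimes F\mathbb 1\xrightarrow{x\otimes\varepsilon}x\otimes\mathbb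 1\xrightarrow{\rho_x}x,$$ $$G\,\underline{\mathcal C}(x,y^{Fw})\xrightarrow{G\psi}G[Fw,\underline{\mathcal C}(x,y)]\to[w,G\,\underline{\mathcal C}(x,y)],\qquad y\xrightarrow{\eta_y}y^{\mathbb 1}\xrightarrow{y^\varepsilon}y^{F\mathbb 1}.$$ Here the map $G[Fw,v]\to[w,Gv]$ is the one induced by $\delta$ and the adjunctions. 2. If moreover the weak tensoring (resp. weak cotensoring) of $\mathcal C$ is set-compatible, then so is that of $G_*\mathcal C$; if it is unital, then so is that of $G_*\mathcal C$. 3. A $\mathcal V$-model category $\mathcal C$ is in particular a weak $\mathcal V$-model category, with a set-compatible and unital weak tensoring and weak cotensoring; hence $G_*\mathcal C$ is then a weak $\mathcal W$-model category with a set-compatible and unital weak tensoring and weak cotensoring. -/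

import Mathlib

open CategoryTheory MonoidalCategory HomotopicalAlgebra Limits Opposite

universe v₁ v₂ v₃ u₁ u₂ u₃

noncomputable section

namespace WeakEnriched

/-! ## Monoidal model categories and weak monoidal Quillen adjunctions -/

section Monoidal

/-- The pushout-product axiom for a functor of two variables `T : A ⥤ B ⥤ D` between model
categories: for cofibrations `i` and `k`, the pushout-product `i □ k` is a cofibration, which is
acyclic if `i` or `k` is. -/
def PushoutProductAxiom {A : Type u₁} {B : Type u₂} {D : Type u₃}
    [Category.{v₁} A] [Category.{v₂} B] [Category.{v₃} D]
    [ModelCategory A] [ModelCategory B] [ModelCategory D] (T : A ⥤ B ⥤ D) : Prop :=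
  ∀ ⦃x y : A⦄ (i : x ⟶ y) ⦃a b : B⦄ (k : a ⟶ b), Cofibration i → Cofibration k →
    ∀ sq : T.PushoutObjObj i k,
      Cofibration sq.ι ∧ (WeakEquivalence i ∨ WeakEquivalence k → WeakEquivalence sq.ι)

/-- The pullback-power axiom for a functor of two variables `P : Aᵒᵖ ⥤ B ⥤ D` between model
categories: for a cofibration `i : a ⟶ b` and a fibration `p : x ⟶ y`, the map
`P(b, x) ⟶ P(a, x) ×_{P(a, y)} P(b, y)` is a fibration, which is acyclic if `i` or `p` is. -/
def PullbackPowerAxiom {A : Type u₁} {B : Type u₂} {D : Type u₃}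
    [Category.{v₁} A] [Category.{v₂} B] [Category.{v₃} D]
    [ModelCategory A] [ModelCategory B] [ModelCategory D] (P : Aᵒᵖ ⥤ B ⥤ D) : Prop :=
  ∀ ⦃a b : A⦄ (i : a ⟶ b) ⦃x y : B⦄ (p : x ⟶ y), Cofibration i → Fibration p →
    ∀ sq : P.PullbackObjObj i p,
      Fibration sq.π ∧ (WeakEquivalence i ∨ WeakEquivalence p → WeakEquivalence sq.π)

/-- `q : Q ⟶ z` exhibits `Q` as a cofibrant replacement of `z`. -/
structure IsCofibrantReplacement {A : Type u₁} [Category.{v₁} A] [ModelCategory A]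
    {Q z : A} (q : Q ⟶ z) : Prop where
  isCofibrant : IsCofibrant Q
  weakEquivalence : WeakEquivalence q

/-- The axioms of a monoidal model category, for a closed monoidal category with a model
structure. -/
structure IsMonoidalModelCategory (V : Type u₁) [Category.{v₁} V] [MonoidalCategory V]
    [ModelCategory V] : Prop where
  pushoutProduct : PushoutProductAxiom (curriedTensor V)
  unit : ∀ (x : V), IsCofibrant x → ∀ ⦃Q : V⦄ (q : Q ⟶ 𝟙_ V), IsCofibrantReplacement q →
    WeakEquivalence (x ◁ q ≫ (ρ_ x).hom)

variable {V : Type u₁} [Category.{v₁} V] [MonoidalCategory V]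
  {W : Type u₂} [Category.{v₂} W] [MonoidalCategory W]
  {F : W ⥤ V} {G : V ⥤ W}

/-- The adjunction `F ⊣ G` is a Quillen adjunction: the left adjoint preserves cofibrations and
acyclic cofibrations. -/
structure IsQuillenAdjunction [ModelCategory V] [ModelCategory W] (_adj : F ⊣ G) : Prop where
  cofibration : ∀ ⦃x y : W⦄ (i : x ⟶ y), Cofibration i → Cofibration (F.map i)
  weakEquivalence : ∀ ⦃x y : W⦄ (i : x ⟶ y), Cofibration i → WeakEquivalence i →
    WeakEquivalence (F.map i)

/-- A weak monoidal Quillen adjunction: `G` is lax monoidal, and the corresponding oplax monoidal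
structure of `F` (the compatibility is `adj.IsMonoidal`) satisfies the two conditions. -/
structure IsWeakMonoidalQuillenAdjunction [ModelCategory V] [ModelCategory W] (adj : F ⊣ G)
    [F.OplaxMonoidal] [G.LaxMonoidal] [adj.IsMonoidal] : Prop where
  quillen : IsQuillenAdjunction adj
  tensor : ∀ x y : W, IsCofibrant x → IsCofibrant y →
    WeakEquivalence (Functor.OplaxMonoidal.δ F x y)
  unit : ∃ (Q : W) (q : Q ⟶ 𝟙_ W), IsCofibrantReplacement q ∧
    WeakEquivalence (F.map q ≫ Functor.OplaxMonoidal.η F)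

end Monoidal

/-! ## Weak (co)tensorings and weak `V`-model categories -/

section Enriched

variable (V : Type u₁) [Category.{v₁} V] [MonoidalCategory V]
  (C : Type u₃) [Category.{v₃} C] [EnrichedOrdinaryCategory V C]

variable {C} in
/-- The hom object of an enriched category. -/
abbrev eHom (x y : C) : V := EnrichedCategory.Hom x y

variable {V} in
/-- The canonical isomorphism `a ⟶ [𝟙, a]`, adjunct to `𝟙 ⊗ a ≅ a`. -/
def toUnitIHom [MonoidalClosed V] (a : V) : a ⟶ (ihom (𝟙_ V)).obj a :=
  MonoidalClosed.curry (λ_ a).hom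

/-- The data underlying a weak tensoring: a bifunctor `(x, v) ↦ x ⊗ v`, maps
`φ : C(x ⊗ v, y) ⟶ [v, C(x, y)]` and maps `ρ : x ⊗ 𝟙 ⟶ x`. -/
structure TensoringData [MonoidalClosed V] where
  tensor : C ⥤ V ⥤ C
  φ (v : V) (x y : C) : eHom V ((tensor.obj x).obj v) y ⟶ (ihom v).obj (eHom V x y)
  ρ (x : C) : (tensor.obj x).obj (𝟙_ V) ⟶ x

/-- The data underlying a weak cotensoring: a bifunctor `(v, y) ↦ y ^ v`, maps
`ψ : C(x, y ^ v) ⟶ [v, C(x, y)]` and maps `η : y ⟶ y ^ 𝟙`. -/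
structure CotensoringData [MonoidalClosed V] where
  cotensor : Vᵒᵖ ⥤ C ⥤ C
  ψ (v : V) (x y : C) : eHom V x ((cotensor.obj (op v)).obj y) ⟶ (ihom v).obj (eHom V x y)
  η (y : C) : y ⟶ (cotensor.obj (op (𝟙_ V))).obj y

/-- SM7: the pullback-power axiom for the hom bifunctor with values in `V`. -/
def SM7 [ModelCategory V] [ModelCategory C] : Prop :=
  PullbackPowerAxiom (eHomFunctor V C)

/-- The `π₀` of mapping space axiom: for `x` cofibrant and `y` fibrant, the canonical map
`[x, y] ⟶ [𝟙, C(x, y)]` between hom-sets of the homotopy categories is bijective. The canonical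
map is the one that sends the class of `f : x ⟶ y` to the class of the morphism `𝟙 ⟶ C(x, y)`
corresponding to `f`; there is at most one such map, as every element of `[x, y]` is the class of
a morphism. -/
def PiZeroAxiom [ModelCategory V] [ModelCategory C] : Prop :=
  ∀ x y : C, IsCofibrant x → IsFibrant y →
    ∃ Φ : ((weakEquivalences C).Q.obj x ⟶ (weakEquivalences C).Q.obj y) →
        ((weakEquivalences V).Q.obj (𝟙_ V) ⟶ (weakEquivalences V).Q.obj (eHom V x y)),
      Function.Bijective Φ ∧
      ∀ f : x ⟶ y, Φ ((weakEquivalences C).Q.map f) = (weakEquivalences V).Q.map (eHomEquiv V f)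

variable {V C}

namespace TensoringData

variable [MonoidalClosed V] (T : TensoringData V C)

/-- The axioms of a weak tensoring. -/
structure IsWeakTensoring [ModelCategory V] [ModelCategory C] : Prop where
  pushoutProduct : PushoutProductAxiom T.tensor
  /-- With a genuine tensoring this is an instance of the pushout-product axiom; here it has to be
  required, as the bifunctor need not preserve initial objects. -/
  isCofibrant_tensor : ∀ (x : C) (v : V), IsCofibrant x → IsCofibrant v →
    IsCofibrant ((T.tensor.obj x).obj v)
  φ_naturality_left : ∀ (v : V) ⦃x x' : C⦄ (f : x ⟶ x') (y : C),
    eHomWhiskerRight V ((T.tensor.map f).app v) y ≫ T.φ v x y =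
      T.φ v x' y ≫ (ihom v).map (eHomWhiskerRight V f y)
  φ_naturality_mid : ∀ ⦃v v' : V⦄ (g : v ⟶ v') (x y : C),
    eHomWhiskerRight V ((T.tensor.obj x).map g) y ≫ T.φ v x y =
      T.φ v' x y ≫ (MonoidalClosed.pre g).app (eHom V x y)
  φ_naturality_right : ∀ (v : V) (x : C) ⦃y y' : C⦄ (h : y ⟶ y'),
    eHomWhiskerLeft V ((T.tensor.obj x).obj v) h ≫ T.φ v x y' =
      T.φ v x y ≫ (ihom v).map (eHomWhiskerLeft V x h)
  φ_weakEquivalence : ∀ (v : V) (x y : C), IsCofibrant v → IsCofibrant x → IsFibrant y →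
    WeakEquivalence (T.φ v x y)
  ρ_naturality : ∀ ⦃x x' : C⦄ (f : x ⟶ x'),
    (T.tensor.map f).app (𝟙_ V) ≫ T.ρ x' = T.ρ x ≫ f
  ρ_φ : ∀ x y : C, eHomWhiskerRight V (T.ρ x) y ≫ T.φ (𝟙_ V) x y = toUnitIHom (eHom V x y)

/-- The maps `φ` induce bijections on underlying sets. -/
def IsSetCompatible : Prop :=
  ∀ (v : V) (x y : C), Function.Bijective
    (fun f : 𝟙_ V ⟶ eHom V ((T.tensor.obj x).obj v) y => f ≫ T.φ v x y)

/-- The maps `ρ` are isomorphisms. -/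
def IsUnital : Prop := ∀ x : C, IsIso (T.ρ x)

end TensoringData

namespace CotensoringData

variable [MonoidalClosed V] (S : CotensoringData V C)

/-- The axioms of a weak cotensoring. -/
structure IsWeakCotensoring [ModelCategory V] [ModelCategory C] : Prop where
  pullbackPower : PullbackPowerAxiom S.cotensor
  /-- With a genuine cotensoring this is an instance of the pullback-power axiom; here it has to be
  required, as the bifunctor need not preserve terminal objects. -/
  isFibrant_cotensor : ∀ (v : V) (y : C), IsCofibrant v → IsFibrant y →
    IsFibrant ((S.cotensor.obj (op v)).obj y)
  ψ_naturality_left : ∀ (v : V) ⦃x x' : C⦄ (f : x ⟶ x') (y : C),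
    eHomWhiskerRight V f ((S.cotensor.obj (op v)).obj y) ≫ S.ψ v x y =
      S.ψ v x' y ≫ (ihom v).map (eHomWhiskerRight V f y)
  ψ_naturality_mid : ∀ ⦃v v' : V⦄ (g : v ⟶ v') (x y : C),
    eHomWhiskerLeft V x ((S.cotensor.map g.op).app y) ≫ S.ψ v x y =
      S.ψ v' x y ≫ (MonoidalClosed.pre g).app (eHom V x y)
  ψ_naturality_right : ∀ (v : V) (x : C) ⦃y y' : C⦄ (h : y ⟶ y'),
    eHomWhiskerLeft V x ((S.cotensor.obj (op v)).map h) ≫ S.ψ v x y' =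
      S.ψ v x y ≫ (ihom v).map (eHomWhiskerLeft V x h)
  ψ_weakEquivalence : ∀ (v : V) (x y : C), IsCofibrant v → IsCofibrant x → IsFibrant y →
    WeakEquivalence (S.ψ v x y)
  η_naturality : ∀ ⦃y y' : C⦄ (h : y ⟶ y'),
    h ≫ S.η y' = S.η y ≫ (S.cotensor.obj (op (𝟙_ V))).map h
  η_ψ : ∀ x y : C, eHomWhiskerLeft V x (S.η y) ≫ S.ψ (𝟙_ V) x y = toUnitIHom (eHom V x y)

/-- The maps `ψ` induce bijections on underlying sets. -/
def IsSetCompatible : Prop :=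
  ∀ (v : V) (x y : C), Function.Bijective
    (fun f : 𝟙_ V ⟶ eHom V x ((S.cotensor.obj (op v)).obj y) => f ≫ S.ψ v x y)

/-- The maps `η` are isomorphisms. -/
def IsUnital : Prop := ∀ y : C, IsIso (S.η y)

end CotensoringData

/-- `C`, with its enrichment over `V`, its model structure, the weak tensoring `T` and the weak
cotensoring `S`, is a weak `V`-model category. -/
structure IsWeakModelCategory [MonoidalClosed V] [ModelCategory V] [ModelCategory C]
    (T : TensoringData V C) (S : CotensoringData V C) : Prop where
  sm7 : SM7 V C
  /-- With a genuine (co)tensoring this is an instance of SM7; here it has to be required, as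
  `C(∅, y)` and `C(x, *)` need not be terminal. -/
  isFibrant_eHom : ∀ x y : C, IsCofibrant x → IsFibrant y → IsFibrant (eHom V x y)
  weakTensoring : T.IsWeakTensoring
  weakCotensoring : S.IsWeakCotensoring
  piZero : PiZeroAxiom V C

/-! ## Genuine tensorings, cotensorings and `V`-model categories -/

variable (V C)

/-- A tensoring of `C` over `V`: isomorphisms `C(x ⊗ v, y) ≅ [v, C(x, y)]`, `V`-natural in `y`.
The functoriality of `x ⊗ v` in `x` and `v` is the one for which these isomorphisms are natural in
`x` and `v` (by the Yoneda lemma there is exactly one). -/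
structure Tensoring [MonoidalClosed V] where
  tensor : C ⥤ V ⥤ C
  iso (v : V) (x y : C) : eHom V ((tensor.obj x).obj v) y ≅ (ihom v).obj (eHom V x y)
  /-- `V`-naturality in `y`: compatibility with the action of `C(y, z)` by composition. -/
  enriched_naturality (v : V) (x y z : C) :
    eComp V ((tensor.obj x).obj v) y z ≫ (iso v x z).hom =
      (iso v x y).hom ▷ eHom V y z ≫ MonoidalClosed.curry
        ((α_ v ((ihom v).obj (eHom V x y)) (eHom V y z)).inv ≫
          (ihom.ev v).app (eHom V x y) ▷ eHom V y z ≫ eComp V x y z)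
  naturality_left (v : V) {x x' : C} (f : x ⟶ x') (y : C) :
    eHomWhiskerRight V ((tensor.map f).app v) y ≫ (iso v x y).hom =
      (iso v x' y).hom ≫ (ihom v).map (eHomWhiskerRight V f y)
  naturality_mid {v v' : V} (g : v ⟶ v') (x y : C) :
    eHomWhiskerRight V ((tensor.obj x).map g) y ≫ (iso v x y).hom =
      (iso v' x y).hom ≫ (MonoidalClosed.pre g).app (eHom V x y)

/-- A cotensoring of `C` over `V`: isomorphisms `C(x, y ^ v) ≅ [v, C(x, y)]`, `V`-natural in `x`.
The functoriality of `y ^ v` in `y` and `v` is the one for which these isomorphisms are natural in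
`y` and `v` (by the Yoneda lemma there is exactly one). -/
structure Cotensoring [MonoidalClosed V] [BraidedCategory V] where
  cotensor : Vᵒᵖ ⥤ C ⥤ C
  iso (v : V) (x y : C) :
    eHom V x ((cotensor.obj (op v)).obj y) ≅ (ihom v).obj (eHom V x y)
  /-- `V`-naturality in `x`: compatibility with the action of `C(w, x)` by composition. -/
  enriched_naturality (v : V) (w x y : C) :
    eComp V w x ((cotensor.obj (op v)).obj y) ≫ (iso v w y).hom =
      eHom V w x ◁ (iso v x y).hom ≫ MonoidalClosed.curry
        ((α_ v (eHom V w x) ((ihom v).obj (eHom V x y))).inv ≫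
          (β_ v (eHom V w x)).hom ▷ (ihom v).obj (eHom V x y) ≫
          (α_ (eHom V w x) v ((ihom v).obj (eHom V x y))).hom ≫
          eHom V w x ◁ (ihom.ev v).app (eHom V x y) ≫ eComp V w x y)
  naturality_mid {v v' : V} (g : v ⟶ v') (x y : C) :
    eHomWhiskerLeft V x ((cotensor.map g.op).app y) ≫ (iso v x y).hom =
      (iso v' x y).hom ≫ (MonoidalClosed.pre g).app (eHom V x y)
  naturality_right (v : V) (x : C) {y y' : C} (h : y ⟶ y') :
    eHomWhiskerLeft V x ((cotensor.obj (op v)).map h) ≫ (iso v x y').hom =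
      (iso v x y).hom ≫ (ihom v).map (eHomWhiskerLeft V x h)

variable {V C}

/-- A tensoring, seen as a weak tensoring; `ρ : x ⊗ 𝟙 ⟶ x` corresponds to the identity of `x`
under `C(x ⊗ 𝟙, x) ≅ [𝟙, C(x, x)] ≅ C(x, x)`. -/
def Tensoring.toData [MonoidalClosed V] (T : Tensoring V C) : TensoringData V C where
  tensor := T.tensor
  φ v x y := (T.iso v x y).hom
  ρ x := (eHomEquiv V).symm (eId V x ≫ toUnitIHom (eHom V x x) ≫ (T.iso (𝟙_ V) x x).inv)

/-- A cotensoring, seen as a weak cotensoring; `η : y ⟶ y ^ 𝟙` corresponds to the identity of `y`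
under `C(y, y ^ 𝟙) ≅ [𝟙, C(y, y)] ≅ C(y, y)`. -/
def Cotensoring.toData [MonoidalClosed V] [BraidedCategory V] (S : Cotensoring V C) :
    CotensoringData V C where
  cotensor := S.cotensor
  ψ v x y := (S.iso v x y).hom
  η y := (eHomEquiv V).symm (eId V y ≫ toUnitIHom (eHom V y y) ≫ (S.iso (𝟙_ V) y y).inv)

/-- `C`, with its enrichment over `V`, its model structure, the tensoring `T` and the cotensoring
`S`, is a `V`-model category. (The two axioms only involve the tensoring.) -/
structure IsGenuineModelCategory [MonoidalClosed V] [BraidedCategory V] [ModelCategory V]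
    [ModelCategory C] (T : Tensoring V C) (_S : Cotensoring V C) : Prop where
  pushoutProduct : PushoutProductAxiom T.tensor
  unit : ∀ x : C, IsCofibrant x → ∀ ⦃Q : V⦄ (q : Q ⟶ 𝟙_ V), IsCofibrantReplacement q →
    WeakEquivalence ((T.tensor.obj x).map q ≫ T.toData.ρ x)

end Enriched

/-! ## Change of enrichment along the right adjoint -/

section ChangeOfEnrichment

variable {V : Type u₁} [Category.{v₁} V] [MonoidalCategory V]
  {W : Type u₂} [Category.{v₂} W] [MonoidalCategory W]
  {F : W ⥤ V} {G : V ⥤ W} (adj : F ⊣ G) [F.OplaxMonoidal] [G.LaxMonoidal] [adj.IsMonoidal]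
  (C : Type u₃) [Category.{v₃} C] [EnrichedOrdinaryCategory V C]

/-- The category `G_* C` with the same objects as `C` and hom objects `G(C(x, y))`. -/
@[nolint unusedArguments]
def ChangeOfEnrichment (_adj : F ⊣ G) (C : Type u₃) : Type u₃ := TransportEnrichment G C

instance : Category.{v₃} (ChangeOfEnrichment adj C) :=
  inferInstanceAs (Category (TransportEnrichment G C))

/-- The underlying category of `G_* C` is that of `C`, and carries the same model structure. -/
instance [ModelCategory C] : ModelCategory (ChangeOfEnrichment adj C) :=
  inferInstanceAs (ModelCategory C)

/-- The identity functor `G_* C ⥤ C` of underlying categories. -/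
def toBase : ChangeOfEnrichment adj C ⥤ C := 𝟭 C

/-- The identity functor `C ⥤ G_* C` of underlying categories. -/
def ofBase : C ⥤ ChangeOfEnrichment adj C := 𝟭 C

/-- `G` preserves underlying sets if the oplax counit `F(𝟙) ⟶ 𝟙` is an isomorphism. -/
def unitHomEquiv [IsIso (Functor.OplaxMonoidal.η F)] (v : V) :
    (𝟙_ V ⟶ v) ≃ (𝟙_ W ⟶ G.obj v) where
  toFun f := Functor.LaxMonoidal.ε G ≫ G.map f
  invFun g := inv (Functor.OplaxMonoidal.η F) ≫ F.map g ≫ adj.counit.app v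
  left_inv f := by
    beta_reduce
    rw [Functor.map_comp, Category.assoc, adj.counit_naturality,
      adj.map_ε_comp_counit_app_unit_assoc, IsIso.inv_hom_id_assoc]
  right_inv g := by
    beta_reduce
    rw [← adj.unit_app_unit_comp_map_η, Category.assoc, ← G.map_comp, IsIso.hom_inv_id_assoc,
      G.map_comp, adj.unit_naturality_assoc, adj.right_triangle_components, Category.comp_id]

/-- The enrichment of `G_* C` over `W`. A morphism `x ⟶ y`, seen as `𝟙 ⟶ C(x, y)`, corresponds to
`𝟙 ⟶ G(𝟙) ⟶ G(C(x, y))`. -/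
instance [IsIso (Functor.OplaxMonoidal.η F)] :
    EnrichedOrdinaryCategory W (ChangeOfEnrichment adj C) :=
  TransportEnrichment.enrichedOrdinaryCategory C G (unitHomEquiv adj) (fun _ _ => rfl)

/-- The comparison map `G[F(w), v] ⟶ [w, G(v)]`, adjunct to
`F(w ⊗ G[F(w), v]) ⟶ F(w) ⊗ FG[F(w), v] ⟶ F(w) ⊗ [F(w), v] ⟶ v`. -/
def ihomComparison [MonoidalClosed V] [MonoidalClosed W] (w : W) (v : V) :
    G.obj ((ihom (F.obj w)).obj v) ⟶ (ihom w).obj (G.obj v) :=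
  MonoidalClosed.curry (adj.homEquiv _ _
    (Functor.OplaxMonoidal.δ F w (G.obj ((ihom (F.obj w)).obj v)) ≫
      F.obj w ◁ adj.counit.app ((ihom (F.obj w)).obj v) ≫ (ihom.ev (F.obj w)).app v))

variable {C} [IsIso (Functor.OplaxMonoidal.η F)] [MonoidalClosed V] [MonoidalClosed W]

/-- The induced weak tensoring `x ⊗ w := x ⊗ F(w)` of `G_* C`, with structure maps
`G(C(x ⊗ F(w), y)) ⟶ G[F(w), C(x, y)] ⟶ [w, G(C(x, y))]` and `x ⊗ F(𝟙) ⟶ x ⊗ 𝟙 ⟶ x`. -/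
def TensoringData.changeOfEnrichment (T : TensoringData V C) :
    TensoringData W (ChangeOfEnrichment adj C) where
  tensor := toBase adj C ⋙ T.tensor ⋙ (Functor.whiskeringLeft W V C).obj F ⋙
    (Functor.whiskeringRight W C (ChangeOfEnrichment adj C)).obj (ofBase adj C)
  φ w x y := G.map (T.φ (F.obj w) ((toBase adj C).obj x) ((toBase adj C).obj y)) ≫
    ihomComparison adj w (eHom V ((toBase adj C).obj x) ((toBase adj C).obj y))
  ρ x := (ofBase adj C).map
    ((T.tensor.obj ((toBase adj C).obj x)).map (Functor.OplaxMonoidal.η F) ≫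
      T.ρ ((toBase adj C).obj x))

/-- The induced weak cotensoring `y ^ w := y ^ F(w)` of `G_* C`, with structure maps
`G(C(x, y ^ F(w))) ⟶ G[F(w), C(x, y)] ⟶ [w, G(C(x, y))]` and `y ⟶ y ^ 𝟙 ⟶ y ^ F(𝟙)`. -/
def CotensoringData.changeOfEnrichment (S : CotensoringData V C) :
    CotensoringData W (ChangeOfEnrichment adj C) where
  cotensor := F.op ⋙ S.cotensor ⋙
    (Functor.whiskeringLeft (ChangeOfEnrichment adj C) C C).obj (toBase adj C) ⋙
    (Functor.whiskeringRight (ChangeOfEnrichment adj C) C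
      (ChangeOfEnrichment adj C)).obj (ofBase adj C)
  ψ w x y := G.map (S.ψ (F.obj w) ((toBase adj C).obj x) ((toBase adj C).obj y)) ≫
    ihomComparison adj w (eHom V ((toBase adj C).obj x) ((toBase adj C).obj y))
  η y := (ofBase adj C).map
    (S.η ((toBase adj C).obj y) ≫
      (S.cotensor.map (Functor.OplaxMonoidal.η F).op).app ((toBase adj C).obj y))

end ChangeOfEnrichment

end WeakEnriched

end

/-!
Everything rests on one fact about a Quillen adjunction `L ⊣ R`, the derived adjunction
`IsQuillenAdjunction.exists_derivedHomEquiv`: for `X` cofibrant and `Y` fibrant, the bijection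
`Hom(L X, Y) ≃ Hom(X, R Y)` descends to the hom-sets `[L X, Y] ≃ [X, R Y]` of the homotopy
categories. By the fundamental lemma of homotopical algebra, these consist of homotopy classes, and
the adjunction preserves homotopies as `L` preserves good cylinders of cofibrant objects and `R`
good path objects of fibrant objects. If `q : Q ⟶ z` is a cofibrant replacement and `L Q ⟶ L z ⟶ t`
is a weak equivalence, it follows that `[t, Y] ≃ [z, R Y]`
(`exists_derivedHomEquiv_of_isCofibrantReplacement`). Applied to `z = 𝟙`, this yields both `π₀`
axioms: for `G_* C`, take `F ⊣ G` and the unit condition of a weak monoidal Quillen adjunction;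
for a `V`-model category, take `x ⊗ - ⊣ C(x, -)` and the external unit axiom.

The other homotopical ingredient for `G_* C` is that the comparison map `G[F(w), v] ⟶ [w, G(v)]` is
a weak equivalence for `w` cofibrant and `v` fibrant (`weakEquivalence_ihomComparison`). By adjunction
it represents, on a cofibrant object `x`, precomposition with `δ : F(w ⊗ x) ⟶ F(w) ⊗ F(x)`, which is
bijective in the homotopy category; Yoneda's lemma and the saturation of weak equivalences
(`weakEquivalence_of_isIso_Q_map`) conclude. The same description, for `x = 𝟙`, where `δ` is an
isomorphism since the counit `η : F(𝟙) ⟶ 𝟙` is one, gives set-compatibility. The remaining axioms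
for `G_* C` hold because `F` preserves (acyclic) cofibrations and `G` preserves pullbacks, (acyclic)
fibrations, and weak equivalences of fibrant objects, and because the comparison map is natural.

A genuine tensoring is part of two adjunctions of two variables, with `C(-, -)` and with the
cotensoring; so SM7 and the pullback-power axiom are adjoint forms of the pushout-product axiom
(`PushoutProductAxiom.pullbackPowerAxiom`), and `x ⊗ -` and `- ⊗ v` are left Quillen for cofibrant
`x` and `v`, which gives the conditions on (co)fibrant objects. The missing naturality and the unit
conditions are consequences of `V`-naturality.
-/

universe v₄ u₄

noncomputable section

namespace WeakEnriched

/-! ### Weak equivalences and the homotopy category -/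

section ModelCategory

variable {A : Type u₁} [Category.{v₁} A] [ModelCategory A]

lemma isIso_Q_map {X Y : A} (f : X ⟶ Y) (hf : WeakEquivalence f) :
    IsIso ((weakEquivalences A).Q.map f) :=
  (weakEquivalences A).Q_inverts f hf.mem

lemma fibration_of_hasLiftingProperty {X Y : A} (p : X ⟶ Y)
    (h : ∀ ⦃a b : A⦄ (i : a ⟶ b), Cofibration i → WeakEquivalence i → HasLiftingProperty i p) :
    Fibration p := by
  rw [fibration_iff, ← trivialCofibrations_rlp]
  intro a b i hi
  obtain ⟨h₁, h₂⟩ := (mem_trivialCofibrations_iff i).1 hi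
  exact h i h₁ h₂

lemma weakEquivalence_of_hasLiftingProperty {X Y : A} (p : X ⟶ Y)
    (h : ∀ ⦃a b : A⦄ (i : a ⟶ b), Cofibration i → HasLiftingProperty i p) :
    WeakEquivalence p := by
  have : trivialFibrations A p := by
    rw [← cofibrations_rlp]
    intro a b i hi
    exact h i ⟨hi⟩
  exact ((mem_trivialFibrations_iff p).1 this).2

lemma weakEquivalence_of_isIso_Q_map_of_fibration {X Y : A} (p : X ⟶ Y)
    [IsCofibrant X] [IsFibrant X] [IsCofibrant Y] [IsFibrant Y] [Fibration p]
    (hp : IsIso ((weakEquivalences A).Q.map p)) : WeakEquivalence p := by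
  let L := (weakEquivalences A).Q
  have : IsIso (L.map p) := hp
  obtain ⟨s, hs⟩ := map_surjective_of_isLocalization L Y X (inv (L.map p))
  have h₁ : LeftHomotopyRel (s ≫ p) (𝟙 Y) := by
    rw [LeftHomotopyRel.iff_map_eq L, L.map_comp, hs, IsIso.inv_hom_id, L.map_id]
  obtain ⟨P, _, ⟨h⟩⟩ := h₁.exists_good_cylinder
  -- Covering homotopy: `s` can be deformed into a strict section `q` of `p`.
  obtain ⟨q, h', hh'⟩ := h.covering_homotopy p s rfl
  have hq : q ≫ p = 𝟙 Y := by rw [← h'.h₁, Category.assoc, hh', h.h₁]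
  have hLq : L.map p ≫ L.map q = 𝟙 _ := by
    rw [← cancel_mono (L.map p), Category.assoc, ← L.map_comp, hq, L.map_id, Category.comp_id,
      Category.id_comp]
  have h₂ : LeftHomotopyRel (p ≫ q) (𝟙 X) := by
    rw [LeftHomotopyRel.iff_map_eq L, L.map_comp, hLq, L.map_id]
  obtain ⟨P', ⟨k⟩⟩ := h₂
  have hpq : weakEquivalences A (p ≫ q) := (k.weakEquivalence_iff.2 inferInstance).mem
  -- `p` is a retract of `p ≫ q`, which is homotopic to the identity.
  have r : RetractArrow p (p ≫ q) :=
    { i := Arrow.homMk (𝟙 X) q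
      r := Arrow.homMk (𝟙 X) p (by simp [hq])
      retract := by ext <;> simp [hq] }
  exact ⟨MorphismProperty.of_retract r hpq⟩

/-- The weak equivalences are saturated. The general case reduces to that of fibrant objects, which
is the one needed here. -/
lemma weakEquivalence_of_isIso_Q_map {X Y : A} (f : X ⟶ Y) [IsFibrant X] [IsFibrant Y]
    (hf : IsIso ((weakEquivalences A).Q.map f)) : WeakEquivalence f := by
  let L := (weakEquivalences A).Q
  have : IsIso (L.map f) := hf
  obtain ⟨X', _, p, _, _⟩ := CofibrantObject.HoCat.exists_resolution X
  obtain ⟨Y', _, q, _, _⟩ := CofibrantObject.HoCat.exists_resolution Y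
  have : IsFibrant X' := isFibrant_of_fibration p
  have : IsFibrant Y' := isFibrant_of_fibration q
  have sq : CommSq (initial.to Y') (initial.to X') q (p ≫ f) := ⟨Subsingleton.elim _ _⟩
  have fac : sq.lift ≫ q = p ≫ f := sq.fac_right
  have : IsIso (L.map p) := isIso_Q_map p inferInstance
  have : IsIso (L.map q) := isIso_Q_map q inferInstance
  have hl : IsIso (L.map sq.lift) := by
    have : IsIso (L.map sq.lift ≫ L.map q) := by
      rw [← L.map_comp, fac, L.map_comp]
      infer_instance
    exact IsIso.of_isIso_comp_right _ (L.map q)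
  have : WeakEquivalence sq.lift := by
    let d := MorphismProperty.factorizationData (trivialCofibrations A) (fibrations A) sq.lift
    have : IsCofibrant d.Z := isCofibrant_of_cofibration d.i
    have : IsFibrant d.Z := isFibrant_of_fibration d.p
    have : IsIso (L.map d.i) := isIso_Q_map d.i inferInstance
    have : IsIso (L.map d.i ≫ L.map d.p) := by
      rw [← L.map_comp, d.fac]
      exact hl
    have := weakEquivalence_of_isIso_Q_map_of_fibration d.p
      (IsIso.of_isIso_comp_left (L.map d.i) _)
    rw [← d.fac]
    infer_instance
  have : WeakEquivalence (p ≫ f) := by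
    rw [← fac]
    infer_instance
  exact weakEquivalence_of_precomp p f

/-- Yoneda's lemma in the homotopy category, tested on the images of the cofibrant objects. -/
lemma isIso_Q_map_of_bijective {X Y : A} (f : X ⟶ Y)
    (h : ∀ Z : A, IsCofibrant Z → Function.Bijective
      fun g : (weakEquivalences A).Q.obj Z ⟶ (weakEquivalences A).Q.obj X =>
        g ≫ (weakEquivalences A).Q.map f) :
    IsIso ((weakEquivalences A).Q.map f) := by
  let L := (weakEquivalences A).Q
  obtain ⟨X', hX', p, _, _⟩ := CofibrantObject.HoCat.exists_resolution X
  obtain ⟨Y', hY', q, _, _⟩ := CofibrantObject.HoCat.exists_resolution Y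
  have : IsIso (L.map p) := isIso_Q_map p inferInstance
  have : IsIso (L.map q) := isIso_Q_map q inferInstance
  obtain ⟨g, hg⟩ := (h Y' hY').2 (L.map q)
  dsimp only at hg
  have hg' : (inv (L.map q) ≫ g) ≫ L.map f = 𝟙 _ := by
    rw [Category.assoc]
    exact (IsIso.inv_comp_eq _).2 (hg.trans (Category.comp_id _).symm)
  refine ⟨inv (L.map q) ≫ g, ?_, hg'⟩
  rw [← cancel_epi (L.map p)]
  apply (h X' hX').1
  change (L.map p ≫ L.map f ≫ inv (L.map q) ≫ g) ≫ L.map f = (L.map p ≫ 𝟙 _) ≫ L.map f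
  rw [Category.assoc, Category.assoc, hg', Category.comp_id, Category.comp_id]

end ModelCategory

/-! ### Quillen adjunctions -/

section Quillen

variable {A : Type u₁} [Category.{v₁} A] [ModelCategory A]
  {B : Type u₂} [Category.{v₂} B] [ModelCategory B]
  {L : A ⥤ B} {R : B ⥤ A} {adj : L ⊣ R}

namespace IsQuillenAdjunction

variable (h : IsQuillenAdjunction adj)
include h

lemma isCofibrant_obj {X : A} (hX : IsCofibrant X) : IsCofibrant (L.obj X) := by
  have := adj.leftAdjoint_preservesColimits
  exact (isCofibrant_iff_of_isInitial (L.map (initial.to X))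
    (IsInitial.isInitialObj L _ initialIsInitial)).2 (h.cofibration _ hX)

lemma fibration_map {X Y : B} (p : X ⟶ Y) (hp : Fibration p) : Fibration (R.map p) :=
  fibration_of_hasLiftingProperty _ fun _ _ i _ hi => by
    have := h.cofibration i ‹_›
    have := h.weakEquivalence i ‹_› hi
    rw [← adj.hasLiftingProperty_iff]
    infer_instance

lemma weakEquivalence_map_of_fibration {X Y : B} (p : X ⟶ Y) (hp : Fibration p)
    (hp' : WeakEquivalence p) : WeakEquivalence (R.map p) :=
  weakEquivalence_of_hasLiftingProperty _ fun _ _ i _ => by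
    have := h.cofibration i ‹_›
    rw [← adj.hasLiftingProperty_iff]
    infer_instance

lemma isFibrant_obj {Y : B} (hY : IsFibrant Y) : IsFibrant (R.obj Y) := by
  have := adj.rightAdjoint_preservesLimits
  exact (isFibrant_iff_of_isTerminal (R.map (terminal.from Y))
    (IsTerminal.isTerminalObj R _ terminalIsTerminal)).2 (h.fibration_map _ hY)

lemma weakEquivalence_map_of_isFibrant {X Y : B} (f : X ⟶ Y) (hX : IsFibrant X)
    (hY : IsFibrant Y) (hf : WeakEquivalence f) : WeakEquivalence (R.map f) := by
  let d : FibrantBrownFactorization f := Classical.arbitrary _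
  have := h.weakEquivalence_map_of_fibration d.p inferInstance inferInstance
  have := h.weakEquivalence_map_of_fibration d.r inferInstance inferInstance
  have : WeakEquivalence (R.map d.i) :=
    weakEquivalence_of_postcomp_of_fac (g := R.map d.r) (fg := 𝟙 _)
      (by rw [← R.map_comp, d.i_r, R.map_id])
  rw [← d.fac, R.map_comp]
  infer_instance

lemma Q_map_homEquiv_eq_iff {X : A} {Y : B} (hX : IsCofibrant X) (hY : IsFibrant Y)
    (f g : L.obj X ⟶ Y) :
    (weakEquivalences A).Q.map (adj.homEquiv X Y f) =
        (weakEquivalences A).Q.map (adj.homEquiv X Y g) ↔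
      (weakEquivalences B).Q.map f = (weakEquivalences B).Q.map g := by
  have := h.isCofibrant_obj hX
  have := h.isFibrant_obj hY
  constructor
  · intro hfg
    rw [← LeftHomotopyRel.iff_map_eq] at hfg
    obtain ⟨P, _, ⟨⟨k, hk₀, hk₁⟩⟩⟩ := hfg.exists_good_cylinder
    have h₀ : WeakEquivalence (L.map P.i₀) := h.weakEquivalence _ inferInstance inferInstance
    have hπ : WeakEquivalence (L.map P.π) :=
      weakEquivalence_of_precomp_of_fac (f := L.map P.i₀) (fg := 𝟙 _)
        (by rw [← L.map_comp, P.i₀_π, L.map_id])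
    have := isIso_Q_map _ hπ
    have e : (weakEquivalences B).Q.map (L.map P.i₀) = (weakEquivalences B).Q.map (L.map P.i₁) := by
      rw [← cancel_mono ((weakEquivalences B).Q.map (L.map P.π))]
      simp only [← Functor.map_comp, P.i₀_π, P.i₁_π]
    have hf : f = L.map P.i₀ ≫ (adj.homEquiv _ _).symm k := by
      rw [← adj.homEquiv_naturality_left_symm, hk₀, Equiv.symm_apply_apply]
    have hg : g = L.map P.i₁ ≫ (adj.homEquiv _ _).symm k := by
      rw [← adj.homEquiv_naturality_left_symm, hk₁, Equiv.symm_apply_apply]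
    rw [hf, hg, Functor.map_comp, Functor.map_comp, e]
  · intro hfg
    rw [← RightHomotopyRel.iff_map_eq] at hfg
    obtain ⟨P, _, ⟨⟨k, hk₀, hk₁⟩⟩⟩ := hfg.exists_good_pathObject
    have h₀ : WeakEquivalence (R.map P.p₀) :=
      h.weakEquivalence_map_of_fibration _ inferInstance inferInstance
    have hι : WeakEquivalence (R.map P.ι) :=
      weakEquivalence_of_postcomp_of_fac (g := R.map P.p₀) (fg := 𝟙 _)
        (by rw [← R.map_comp, P.ι_p₀, R.map_id])
    have := isIso_Q_map _ hι
    have e : (weakEquivalences A).Q.map (R.map P.p₀) = (weakEquivalences A).Q.map (R.map P.p₁) := by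
      rw [← cancel_epi ((weakEquivalences A).Q.map (R.map P.ι))]
      simp only [← Functor.map_comp, P.ι_p₀, P.ι_p₁]
    rw [← hk₀, ← hk₁, adj.homEquiv_naturality_right, adj.homEquiv_naturality_right,
      Functor.map_comp, Functor.map_comp, e]

/-- The derived adjunction on a cofibrant and a fibrant object: there, `Q` identifies the hom-sets
of the homotopy categories with homotopy classes, and `adj.homEquiv` respects homotopy. -/
lemma exists_derivedHomEquiv {X : A} {Y : B} (hX : IsCofibrant X) (hY : IsFibrant Y) :
    ∃ Θ : ((weakEquivalences B).Q.obj (L.obj X) ⟶ (weakEquivalences B).Q.obj Y) ≃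
        ((weakEquivalences A).Q.obj X ⟶ (weakEquivalences A).Q.obj (R.obj Y)),
      ∀ f : L.obj X ⟶ Y, Θ ((weakEquivalences B).Q.map f) =
        (weakEquivalences A).Q.map (adj.homEquiv X Y f) := by
  have := h.isCofibrant_obj hX
  have := h.isFibrant_obj hY
  choose s hs using map_surjective_of_isLocalization (weakEquivalences B).Q (L.obj X) Y
  have key (f : L.obj X ⟶ Y) :
      (weakEquivalences A).Q.map (adj.homEquiv X Y (s ((weakEquivalences B).Q.map f))) =
        (weakEquivalences A).Q.map (adj.homEquiv X Y f) :=
    (h.Q_map_homEquiv_eq_iff hX hY _ _).2 (hs _)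
  refine ⟨Equiv.ofBijective (fun α => (weakEquivalences A).Q.map (adj.homEquiv X Y (s α)))
    ⟨fun α β hαβ => ?_, fun γ => ?_⟩, key⟩
  · rw [← hs α, ← hs β]
    exact (h.Q_map_homEquiv_eq_iff hX hY _ _).1 hαβ
  · obtain ⟨g, rfl⟩ := map_surjective_of_isLocalization (weakEquivalences A).Q X (R.obj Y) γ
    obtain ⟨f, rfl⟩ := (adj.homEquiv X Y).surjective g
    exact ⟨_, key f⟩

/-- A variant of the derived adjunction for an object `z` that need not be cofibrant: its value
under the left derived functor is the object `t`, via a cofibrant replacement of `z`. -/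
lemma exists_derivedHomEquiv_of_isCofibrantReplacement {Q z : A} {q : Q ⟶ z}
    (hq : IsCofibrantReplacement q) {t Y : B} {p : L.obj z ⟶ t}
    (hp : WeakEquivalence (L.map q ≫ p)) (hY : IsFibrant Y) :
    ∃ Θ : ((weakEquivalences B).Q.obj t ⟶ (weakEquivalences B).Q.obj Y) ≃
        ((weakEquivalences A).Q.obj z ⟶ (weakEquivalences A).Q.obj (R.obj Y)),
      ∀ f : t ⟶ Y, Θ ((weakEquivalences B).Q.map f) =
        (weakEquivalences A).Q.map (adj.homEquiv z Y (p ≫ f)) := by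
  have := isIso_Q_map _ hp
  have := isIso_Q_map _ hq.weakEquivalence
  obtain ⟨Θ, hΘ⟩ := h.exists_derivedHomEquiv hq.isCofibrant hY
  refine ⟨(asIso ((weakEquivalences B).Q.map (L.map q ≫ p))).homFromEquiv.symm.trans <| Θ.trans
    (asIso ((weakEquivalences A).Q.map q)).homFromEquiv, fun f => ?_⟩
  change inv ((weakEquivalences A).Q.map q) ≫ Θ ((weakEquivalences B).Q.map (L.map q ≫ p) ≫
    (weakEquivalences B).Q.map f) = _
  rw [IsIso.inv_comp_eq, ← Functor.map_comp, hΘ, ← Functor.map_comp, Category.assoc,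
    adj.homEquiv_naturality_left]

end IsQuillenAdjunction

end Quillen

/-! ### Functors of two variables between model categories -/

section Bifunctor

variable {A : Type u₁} [Category.{v₁} A] [ModelCategory A]
  {B : Type u₂} [Category.{v₂} B] [ModelCategory B]
  {D : Type u₃} [Category.{v₃} D] [ModelCategory D]
  {T : A ⥤ B ⥤ D}

namespace PushoutProductAxiom

lemma flip (hT : PushoutProductAxiom T) : PushoutProductAxiom T.flip :=
  fun _ _ i _ _ k hi hk sq => by
    obtain ⟨h₁, h₂⟩ := hT k i hk hi sq.flip
    exact ⟨h₁, fun h => h₂ h.symm⟩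

/-- The partial functors of a Quillen bifunctor at cofibrant objects are left Quillen, provided
that the bifunctor preserves initial objects in its other variable. -/
lemma isQuillenAdjunction (hT : PushoutProductAxiom T)
    [∀ b, PreservesColimitsOfShape (Discrete PEmpty.{1}) (T.flip.obj b)]
    {x : A} (hx : IsCofibrant x) {R : D ⥤ B} (adj : T.obj x ⊣ R) : IsQuillenAdjunction adj where
  cofibration _ _ k hk :=
    (hT _ k hx hk (.ofIsInitialLeft T _ k initialIsInitial)).1
  weakEquivalence _ _ k hk hk' :=
    (hT _ k hx hk (.ofIsInitialLeft T _ k initialIsInitial)).2 (Or.inr hk')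

/-- The adjoint form of the pushout-product axiom. -/
lemma pullbackPowerAxiom (hT : PushoutProductAxiom T) {P : Aᵒᵖ ⥤ D ⥤ B} (adj₂ : T ⊣₂ P) :
    PullbackPowerAxiom P := fun a b i x y p hi hp sq => by
  refine ⟨fibration_of_hasLiftingProperty _ fun c d k hk hk' => ?_,
    fun h => weakEquivalence_of_hasLiftingProperty _ fun c d k hk => ?_⟩
  · rw [← adj₂.hasLiftingProperty_iff (.ofHasPushout T i k) sq]
    obtain ⟨h₁, h₂⟩ := hT i k hi hk (.ofHasPushout T i k)
    have := h₂ (Or.inr hk')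
    infer_instance
  · rw [← adj₂.hasLiftingProperty_iff (.ofHasPushout T i k) sq]
    obtain ⟨h₁, h₂⟩ := hT i k hi hk (.ofHasPushout T i k)
    obtain h | h := h
    · have := h₂ (Or.inl h)
      infer_instance
    · infer_instance

end PushoutProductAxiom

namespace PullbackPowerAxiom

variable {P : Aᵒᵖ ⥤ B ⥤ D}

lemma of_iso (hP : PullbackPowerAxiom P) {P' : Aᵒᵖ ⥤ B ⥤ D} (e : P ≅ P') :
    PullbackPowerAxiom P' := fun a b i x y p hi hp sq => by
  let sq' : P.PullbackObjObj i p :=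
    { pt := sq.pt
      fst := sq.fst ≫ (e.inv.app (op a)).app x
      snd := sq.snd ≫ (e.inv.app (op b)).app y
      isPullback := sq.isPullback.of_iso (Iso.refl _) ((e.symm.app _).app _)
        ((e.symm.app _).app _) ((e.symm.app _).app _) (by simp) (by simp) (by simp) (by simp)
      π := (e.hom.app (op b)).app x ≫ sq.π }
  have h : sq.π = (e.inv.app (op b)).app x ≫ sq'.π := by simp [sq']
  obtain ⟨h₁, h₂⟩ := hP i p hi hp sq'
  refine ⟨?_, fun hip => ?_⟩
  · rw [h]
    infer_instance
  · have := h₂ hip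
    rw [h]
    infer_instance

lemma comp {D' : Type u₄} [Category.{v₄} D'] [ModelCategory D'] (hP : PullbackPowerAxiom P)
    {L : D' ⥤ D} {R : D ⥤ D'} {adj : L ⊣ R} (h : IsQuillenAdjunction adj) :
    PullbackPowerAxiom (P ⋙ (Functor.whiskeringRight B D D').obj R) :=
  fun a b i x y p hi hp sq => by
    have := adj.rightAdjoint_preservesLimits
    let sq' : P.PullbackObjObj i p := .ofHasPullback P i p
    let e : R.obj sq'.pt ≅ sq.pt := (sq'.isPullback.map R).isoIsPullback _ _ sq.isPullback
    have e₁ : e.hom ≫ sq.fst = R.map sq'.fst := IsPullback.isoIsPullback_hom_fst _ _ _ _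
    have e₂ : e.hom ≫ sq.snd = R.map sq'.snd := IsPullback.isoIsPullback_hom_snd _ _ _ _
    have hπ : sq.π = R.map sq'.π ≫ e.hom := by
      apply sq.hom_ext
      · rw [sq.π_fst, Category.assoc, e₁, ← R.map_comp, sq'.π_fst]
        rfl
      · rw [sq.π_snd, Category.assoc, e₂, ← R.map_comp, sq'.π_snd]
        rfl
    obtain ⟨h₁, h₂⟩ := hP i p hi hp sq'
    have := h.fibration_map _ h₁
    refine ⟨?_, fun hip => ?_⟩
    · rw [hπ]
      infer_instance
    · have := h.weakEquivalence_map_of_fibration _ h₁ (h₂ hip)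
      rw [hπ]
      infer_instance

end PullbackPowerAxiom

end Bifunctor

section Monoidal

variable {V : Type u₁} [Category.{v₁} V] [MonoidalCategory V] [BraidedCategory V]
  [MonoidalClosed V] [ModelCategory V]

lemma IsMonoidalModelCategory.isQuillenAdjunction (hV : IsMonoidalModelCategory V) {a : V}
    (ha : IsCofibrant a) : IsQuillenAdjunction (ihom.adjunction a) := by
  have (b : V) : PreservesColimitsOfShape (Discrete PEmpty.{1}) ((curriedTensor V).flip.obj b) :=
    preservesColimitsOfShape_of_natIso (BraidedCategory.tensorLeftIsoTensorRight b)
  exact hV.pushoutProduct.isQuillenAdjunction (T := curriedTensor V) ha (ihom.adjunction a)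

end Monoidal

/-! ### The comparison map of internal homs -/

section Comparison

open Functor.OplaxMonoidal Functor.LaxMonoidal MonoidalClosed

/-- If `η` is an isomorphism, then so is `δ` at the unit, by the unit law of `F`. -/
lemma isIso_δ_unit {V : Type u₁} [Category.{v₁} V] [MonoidalCategory V]
    {W : Type u₂} [Category.{v₂} W] [MonoidalCategory W] (F : W ⥤ V) [F.OplaxMonoidal]
    [IsIso (η F)] (w : W) : IsIso (δ F w (𝟙_ W)) := by
  have h := right_unitality_hom F w
  have : IsIso (δ F w (𝟙_ W) ≫ F.obj w ◁ η F ≫ (ρ_ (F.obj w)).hom) := by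
    rw [h]
    infer_instance
  exact IsIso.of_isIso_comp_right _ (F.obj w ◁ η F ≫ (ρ_ (F.obj w)).hom)

variable {V : Type u₁} [Category.{v₁} V] [MonoidalCategory V] [MonoidalClosed V]
  {W : Type u₂} [Category.{v₂} W] [MonoidalCategory W] [MonoidalClosed W]
  {F : W ⥤ V} {G : V ⥤ W} (adj : F ⊣ G) [F.OplaxMonoidal]

/-- On generalized elements, the comparison map `G[F(w), v] ⟶ [w, G(v)]` is precomposition with
`δ : F(w ⊗ x) ⟶ F(w) ⊗ F(x)`. -/
lemma comp_ihomComparison {w x : W} {v : V} (f : x ⟶ G.obj ((ihom (F.obj w)).obj v)) :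
    f ≫ ihomComparison adj w v =
      curry (adj.homEquiv _ _ (δ F w x ≫ uncurry ((adj.homEquiv _ _).symm f))) := by
  rw [ihomComparison, ← curry_natural_left, ← adj.homEquiv_naturality_left,
    ← δ_natural_right_assoc, uncurry_eq, adj.homEquiv_counit, MonoidalCategory.whiskerLeft_comp,
    Category.assoc]

lemma ihomComparison_naturality (w : W) {v v' : V} (h : v ⟶ v') :
    ihomComparison adj w v ≫ (ihom w).map (G.map h) =
      G.map ((ihom (F.obj w)).map h) ≫ ihomComparison adj w v' := by
  rw [comp_ihomComparison, ihomComparison, ← curry_natural_right, ← adj.homEquiv_naturality_right,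
    adj.homEquiv_counit, adj.counit_naturality, uncurry_natural_right, uncurry_eq]
  simp only [Category.assoc]

lemma map_pre_comp_ihomComparison {w w' : W} (g : w ⟶ w') (v : V) :
    G.map ((pre (F.map g)).app v) ≫ ihomComparison adj w v =
      ihomComparison adj w' v ≫ (pre g).app (G.obj v) := by
  rw [comp_ihomComparison, ihomComparison, curry_pre_app, ← adj.homEquiv_naturality_left,
    ← δ_natural_left_assoc, adj.homEquiv_counit, adj.counit_naturality, uncurry_pre_app,
    uncurry_eq]

lemma map_toUnitIHom_comp_ihomComparison (v : V) :
    G.map (toUnitIHom v ≫ (pre (η F)).app v) ≫ ihomComparison adj (𝟙_ W) v =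
      toUnitIHom (G.obj v) := by
  rw [comp_ihomComparison, adj.homEquiv_counit, adj.counit_naturality, uncurry_natural_left,
    uncurry_pre_app, toUnitIHom, uncurry_curry, whisker_exchange_assoc, leftUnitor_naturality,
    toUnitIHom]
  congr 1
  have := left_unitality_hom F (G.obj v)
  rw [reassoc_of% this, adj.homEquiv_naturality_left, adj.homEquiv_unit,
    adj.right_triangle_components, Category.comp_id]

lemma bijective_comp_ihomComparison (w : W) (x : W) (v : V) (h : IsIso (δ F w x)) :
    Function.Bijective fun f : x ⟶ G.obj ((ihom (F.obj w)).obj v) =>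
      f ≫ ihomComparison adj w v := by
  let e : (x ⟶ G.obj ((ihom (F.obj w)).obj v)) ≃ (x ⟶ (ihom w).obj (G.obj v)) :=
    (adj.homEquiv _ _).symm.trans <| ((ihom.adjunction _).homEquiv _ _).symm.trans <|
      ((asIso (δ F w x)).homFromEquiv).symm.trans <| (adj.homEquiv _ _).trans <|
        (ihom.adjunction _).homEquiv _ _
  convert e.bijective using 2 with f
  exact comp_ihomComparison adj f

/-- In the homotopy category of `W`, the comparison map represents the transformation
`[x, G[F(w), v]] ≅ [F(w) ⊗ F(x), v] ⟶ [F(w ⊗ x), v] ≅ [x, [w, G(v)]]` for cofibrant `x`, and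
the map in the middle is bijective as `δ` is a weak equivalence. -/
lemma weakEquivalence_ihomComparison [SymmetricCategory V] [SymmetricCategory W]
    [ModelCategory V] [ModelCategory W] (hV : IsMonoidalModelCategory V)
    (hW : IsMonoidalModelCategory W) (hadj : IsQuillenAdjunction adj)
    (hδ : ∀ x y : W, IsCofibrant x → IsCofibrant y → WeakEquivalence (δ F x y))
    {w : W} (hw : IsCofibrant w) {v : V} (hv : IsFibrant v) :
    WeakEquivalence (ihomComparison adj w v) := by
  have hFw := hadj.isCofibrant_obj hw
  have qV := hV.isQuillenAdjunction hFw
  have qW := hW.isQuillenAdjunction hw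
  have hv' := qV.isFibrant_obj hv
  have := hadj.isFibrant_obj hv'
  have := qW.isFibrant_obj (hadj.isFibrant_obj hv)
  refine weakEquivalence_of_isIso_Q_map _ (isIso_Q_map_of_bijective _ fun x hx => ?_)
  have hFx := hadj.isCofibrant_obj hx
  have hwx : IsCofibrant (w ⊗ x) := qW.isCofibrant_obj hx
  have := isIso_Q_map _ (hδ w x hw hx)
  obtain ⟨Θ₁, h₁⟩ := hadj.exists_derivedHomEquiv hx hv'
  obtain ⟨Θ₂, h₂⟩ := qV.exists_derivedHomEquiv hFx hv
  obtain ⟨Θ₃, h₃⟩ := hadj.exists_derivedHomEquiv hwx hv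
  obtain ⟨Θ₄, h₄⟩ := qW.exists_derivedHomEquiv hx (hadj.isFibrant_obj hv)
  let e := Θ₁.symm.trans <| Θ₂.symm.trans <|
    (asIso ((weakEquivalences V).Q.map (δ F w x))).homFromEquiv.symm.trans <| Θ₃.trans Θ₄
  convert e.bijective using 2 with α
  obtain ⟨f, rfl⟩ := map_surjective_of_isLocalization (weakEquivalences W).Q _ _ α
  obtain ⟨f, rfl⟩ := (adj.homEquiv _ _).surjective f
  obtain ⟨f, rfl⟩ := ((ihom.adjunction _).homEquiv _ _).surjective f
  rw [← Functor.map_comp, comp_ihomComparison, Equiv.symm_apply_apply]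
  change _ = Θ₄ (Θ₃ ((weakEquivalences V).Q.map (δ F w x) ≫ Θ₂.symm (Θ₁.symm _)))
  rw [← h₁, Equiv.symm_apply_apply, ← h₂, Equiv.symm_apply_apply]
  erw [← Functor.map_comp, h₃, h₄]
  rw [homEquiv_apply_eq, homEquiv_apply_eq, uncurry_curry]

/-! The structure maps of the induced weak (co)tensorings have the form `G(a) ⟶ G[F(w), b] ⟶ [w, G(b)]`
for a map `φ : a ⟶ [F(w), b]`. The following lemmas transfer the properties of `φ` to them. -/

lemma map_comp_ihomComparison_naturality (w : W) {a a' b b' : V} {φ : a ⟶ (ihom (F.obj w)).obj b}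
    {φ' : a' ⟶ (ihom (F.obj w)).obj b'} {s : a ⟶ a'} {t : b ⟶ b'}
    (h : s ≫ φ' = φ ≫ (ihom (F.obj w)).map t) :
    G.map s ≫ G.map φ' ≫ ihomComparison adj w b' =
      (G.map φ ≫ ihomComparison adj w b) ≫ (ihom w).map (G.map t) := by
  rw [Category.assoc, ihomComparison_naturality, ← G.map_comp_assoc, h, G.map_comp_assoc]

lemma map_comp_ihomComparison_naturality_mid {w w' : W} (g : w ⟶ w') {a a' b : V}
    {φ : a ⟶ (ihom (F.obj w')).obj b} {φ' : a' ⟶ (ihom (F.obj w)).obj b} {s : a ⟶ a'}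
    (h : s ≫ φ' = φ ≫ (pre (F.map g)).app b) :
    G.map s ≫ G.map φ' ≫ ihomComparison adj w b =
      (G.map φ ≫ ihomComparison adj w' b) ≫ (pre g).app (G.obj b) := by
  rw [Category.assoc, ← map_pre_comp_ihomComparison, ← G.map_comp_assoc, h, G.map_comp_assoc]

lemma map_comp_ihomComparison_unit {a b : V} {φ : a ⟶ (ihom (F.obj (𝟙_ W))).obj b} {s : b ⟶ a}
    (h : s ≫ φ = toUnitIHom b ≫ (pre (η F)).app b) :
    G.map s ≫ G.map φ ≫ ihomComparison adj (𝟙_ W) b = toUnitIHom (G.obj b) := by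
  rw [← G.map_comp_assoc, h, map_toUnitIHom_comp_ihomComparison]

lemma bijective_comp_map_comp_ihomComparison [G.LaxMonoidal] [adj.IsMonoidal] [IsIso (η F)]
    (w : W) {a b : V} {φ : a ⟶ (ihom (F.obj w)).obj b}
    (h : Function.Bijective fun f : 𝟙_ V ⟶ a => f ≫ φ) :
    Function.Bijective fun f : 𝟙_ W ⟶ G.obj a => f ≫ G.map φ ≫ ihomComparison adj w b := by
  convert (bijective_comp_ihomComparison adj w (𝟙_ W) b (isIso_δ_unit F w)).comp
    ((unitHomEquiv adj _).bijective.comp (h.comp (unitHomEquiv adj a).symm.bijective)) using 1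
  ext f
  obtain ⟨f, rfl⟩ := (unitHomEquiv adj a).surjective f
  simp only [Function.comp_apply, Equiv.symm_apply_apply]
  change (ε G ≫ G.map f) ≫ _ = (ε G ≫ G.map (f ≫ φ)) ≫ _
  rw [G.map_comp, Category.assoc, Category.assoc, Category.assoc]

lemma weakEquivalence_map_comp_ihomComparison [SymmetricCategory V] [SymmetricCategory W]
    [ModelCategory V] [ModelCategory W] (hV : IsMonoidalModelCategory V)
    (hW : IsMonoidalModelCategory W) (hadj : IsQuillenAdjunction adj)
    (hδ : ∀ x y : W, IsCofibrant x → IsCofibrant y → WeakEquivalence (δ F x y))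
    {w : W} (hw : IsCofibrant w) {a b : V} (ha : IsFibrant a) (hb : IsFibrant b)
    {φ : a ⟶ (ihom (F.obj w)).obj b} (hφ : WeakEquivalence φ) :
    WeakEquivalence (G.map φ ≫ ihomComparison adj w b) := by
  have := hadj.weakEquivalence_map_of_isFibrant φ ha
    ((hV.isQuillenAdjunction (hadj.isCofibrant_obj hw)).isFibrant_obj hb) hφ
  have := weakEquivalence_ihomComparison adj hV hW hadj hδ hw hb
  infer_instance

end Comparison

/-! ### Change of enrichment -/

section ChangeOfEnrichment

open Functor.OplaxMonoidal Functor.LaxMonoidal MonoidalClosed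

section

variable {V : Type u₁} [Category.{v₁} V] [MonoidalCategory V]
  {W : Type u₂} [Category.{v₂} W] [MonoidalCategory W]
  {F : W ⥤ V} {G : V ⥤ W} (adj : F ⊣ G) [F.OplaxMonoidal] [G.LaxMonoidal] [adj.IsMonoidal]
  {C : Type u₃} [Category.{v₃} C] [EnrichedOrdinaryCategory V C] [IsIso (η F)]

lemma eHomWhiskerRight_changeOfEnrichment {x x' : ChangeOfEnrichment adj C} (f : x ⟶ x')
    (y : ChangeOfEnrichment adj C) :
    eHomWhiskerRight W f y =
      G.map (eHomWhiskerRight V ((toBase adj C).map f) ((toBase adj C).obj y)) := by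
  change (λ_ _).inv ≫ (ε G ≫ G.map (eHomEquiv V ((toBase adj C).map f))) ▷ _ ≫
    μ G _ _ ≫ G.map (eComp V _ _ ((toBase adj C).obj y)) = _
  rw [eHomWhiskerRight, comp_whiskerRight, Category.assoc, μ_natural_left_assoc,
    left_unitality_inv_assoc, ← G.map_comp, ← G.map_comp]

lemma eHomWhiskerLeft_changeOfEnrichment (x : ChangeOfEnrichment adj C)
    {y y' : ChangeOfEnrichment adj C} (f : y ⟶ y') :
    eHomWhiskerLeft W x f =
      G.map (eHomWhiskerLeft V ((toBase adj C).obj x) ((toBase adj C).map f)) := by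
  change (ρ_ _).inv ≫ _ ◁ (ε G ≫ G.map (eHomEquiv V ((toBase adj C).map f))) ≫
    μ G _ _ ≫ G.map (eComp V ((toBase adj C).obj x) _ _) = _
  rw [eHomWhiskerLeft, MonoidalCategory.whiskerLeft_comp, Category.assoc, μ_natural_right_assoc,
    right_unitality_inv_assoc, ← G.map_comp, ← G.map_comp]

variable [ModelCategory V] [ModelCategory W] [ModelCategory C]

variable (C) in
lemma SM7.changeOfEnrichment (h : SM7 V C) (hadj : IsQuillenAdjunction adj) :
    SM7 W (ChangeOfEnrichment adj C) := by
  let e : (eHomFunctor V C ⋙ (Functor.whiskeringRight C V W).obj G :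
      (ChangeOfEnrichment adj C)ᵒᵖ ⥤ ChangeOfEnrichment adj C ⥤ W) ≅
      eHomFunctor W (ChangeOfEnrichment adj C) :=
    NatIso.ofComponents (fun x => NatIso.ofComponents (fun y => Iso.refl _)
      (fun f => by
        have := eHomWhiskerLeft_changeOfEnrichment adj x.unop f
        exact (Category.comp_id _).trans (this.symm.trans (Category.id_comp _).symm)))
      (fun {x x'} f => by
        ext y
        have := eHomWhiskerRight_changeOfEnrichment adj f.unop y
        exact (Category.comp_id _).trans (this.symm.trans (Category.id_comp _).symm))
  have h' : PullbackPowerAxiom (eHomFunctor V C ⋙ (Functor.whiskeringRight C V W).obj G) :=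
    PullbackPowerAxiom.comp h hadj
  exact PullbackPowerAxiom.of_iso (P := eHomFunctor V C ⋙ (Functor.whiskeringRight C V W).obj G)
    h' e

variable (C) in
lemma PiZeroAxiom.changeOfEnrichment (h : PiZeroAxiom V C)
    (hadj : IsWeakMonoidalQuillenAdjunction adj)
    (hfib : ∀ x y : C, IsCofibrant x → IsFibrant y → IsFibrant (eHom V x y)) :
    PiZeroAxiom W (ChangeOfEnrichment adj C) := by
  intro x y hx hy
  obtain ⟨Φ, hΦ, hΦ'⟩ := h x y hx hy
  obtain ⟨Q, q, hq, hq'⟩ := hadj.unit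
  obtain ⟨Θ, hΘ⟩ := hadj.quillen.exists_derivedHomEquiv_of_isCofibrantReplacement hq hq'
    (hfib x y hx hy)
  refine ⟨Θ ∘ Φ, Θ.bijective.comp hΦ, fun f => ?_⟩
  change Θ (Φ ((weakEquivalences C).Q.map f)) =
    (weakEquivalences W).Q.map (ε G ≫ G.map (eHomEquiv V ((toBase adj C).map f)))
  rw [show Φ ((weakEquivalences C).Q.map f) = _ from hΦ' f, hΘ, adj.homEquiv_unit, G.map_comp, adj.unit_app_unit_comp_map_η_assoc]
  rfl

end

variable {V : Type u₁} [Category.{v₁} V] [MonoidalCategory V] [SymmetricCategory V]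
  [MonoidalClosed V] [ModelCategory V]
  {W : Type u₂} [Category.{v₂} W] [MonoidalCategory W] [SymmetricCategory W]
  [MonoidalClosed W] [ModelCategory W]
  {F : W ⥤ V} {G : V ⥤ W} (adj : F ⊣ G)
  [F.OplaxMonoidal] [G.LaxMonoidal] [adj.IsMonoidal] [IsIso (Functor.OplaxMonoidal.η F)]
  {C : Type u₃} [Category.{v₃} C] [EnrichedOrdinaryCategory V C] [ModelCategory C]

namespace TensoringData

variable {T : TensoringData V C}

lemma IsWeakTensoring.changeOfEnrichment (hT : T.IsWeakTensoring)
    (hV : IsMonoidalModelCategory V) (hW : IsMonoidalModelCategory W)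
    (hadj : IsWeakMonoidalQuillenAdjunction adj)
    (hfib : ∀ x y : C, IsCofibrant x → IsFibrant y → IsFibrant (eHom V x y)) :
    (T.changeOfEnrichment adj).IsWeakTensoring where
  pushoutProduct := fun x y i a b k hi hk sq => by
    let sq' : T.tensor.PushoutObjObj ((toBase adj C).map i) (F.map k) :=
      { pt := sq.pt
        inl := sq.inl
        inr := sq.inr
        isPushout := sq.isPushout
        ι := sq.ι
        inl_ι := sq.inl_ι
        inr_ι := sq.inr_ι }
    obtain ⟨h₁, h₂⟩ := hT.pushoutProduct _ _ hi (hadj.quillen.cofibration k hk) sq'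
    exact ⟨h₁, fun h => h₂ (h.imp_right (hadj.quillen.weakEquivalence k hk))⟩
  isCofibrant_tensor x w hx hw :=
    hT.isCofibrant_tensor ((toBase adj C).obj x) _ hx (hadj.quillen.isCofibrant_obj hw)
  φ_naturality_left w x x' f y := by
    rw [eHomWhiskerRight_changeOfEnrichment, eHomWhiskerRight_changeOfEnrichment]
    exact map_comp_ihomComparison_naturality adj w (hT.φ_naturality_left (F.obj w) f y)
  φ_naturality_mid w w' g x y := by
    rw [eHomWhiskerRight_changeOfEnrichment]
    exact map_comp_ihomComparison_naturality_mid adj g (hT.φ_naturality_mid (F.map g) x y)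
  φ_naturality_right w x y y' h := by
    rw [eHomWhiskerLeft_changeOfEnrichment, eHomWhiskerLeft_changeOfEnrichment]
    exact map_comp_ihomComparison_naturality adj w (hT.φ_naturality_right (F.obj w) x h)
  φ_weakEquivalence w x y hw hx hy :=
    have hFw := hadj.quillen.isCofibrant_obj hw
    weakEquivalence_map_comp_ihomComparison adj hV hW hadj.quillen hadj.tensor hw
      (hfib _ _ (hT.isCofibrant_tensor _ _ hx hFw) hy) (hfib _ _ hx hy)
      (hT.φ_weakEquivalence _ _ _ hFw hx hy)
  ρ_naturality x x' f :=
    have h {x x' : C} (f : x ⟶ x') : (T.tensor.map f).app (F.obj (𝟙_ W)) ≫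
        (T.tensor.obj x').map (η F) ≫ T.ρ x' = ((T.tensor.obj x).map (η F) ≫ T.ρ x) ≫ f := by
      rw [← NatTrans.naturality_assoc, hT.ρ_naturality, Category.assoc]
    h ((toBase adj C).map f)
  ρ_φ x y := by
    rw [eHomWhiskerRight_changeOfEnrichment]
    refine map_comp_ihomComparison_unit adj (φ := T.φ (F.obj (𝟙_ W)) ((toBase adj C).obj x) _) ?_
    change eHomWhiskerRight V ((T.tensor.obj ((toBase adj C).obj x)).map (η F) ≫ T.ρ _) _ ≫ _ = _
    rw [eHomWhiskerRight_comp, Category.assoc, hT.φ_naturality_mid, reassoc_of% hT.ρ_φ]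

omit [SymmetricCategory V] [SymmetricCategory W] [ModelCategory V] [ModelCategory W]
  [ModelCategory C]

lemma IsSetCompatible.changeOfEnrichment (hT : T.IsSetCompatible) :
    (T.changeOfEnrichment adj).IsSetCompatible := fun w x y =>
  bijective_comp_map_comp_ihomComparison adj w
    (hT (F.obj w) ((toBase adj C).obj x) ((toBase adj C).obj y))

lemma IsUnital.changeOfEnrichment (hT : T.IsUnital) : (T.changeOfEnrichment adj).IsUnital :=
  fun x => by
    have h (x : C) : IsIso ((T.tensor.obj x).map (η F) ≫ T.ρ x) :=
      have := hT x
      inferInstance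
    exact h ((toBase adj C).obj x)

end TensoringData

namespace CotensoringData

variable {S : CotensoringData V C}

lemma IsWeakCotensoring.changeOfEnrichment (hS : S.IsWeakCotensoring)
    (hV : IsMonoidalModelCategory V) (hW : IsMonoidalModelCategory W)
    (hadj : IsWeakMonoidalQuillenAdjunction adj)
    (hfib : ∀ x y : C, IsCofibrant x → IsFibrant y → IsFibrant (eHom V x y)) :
    (S.changeOfEnrichment adj).IsWeakCotensoring where
  pullbackPower := fun a b k x y p hk hp sq => by
    let sq' : S.cotensor.PullbackObjObj (F.map k) ((toBase adj C).map p) :=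
      { pt := sq.pt
        fst := sq.fst
        snd := sq.snd
        isPullback := sq.isPullback
        π := sq.π
        π_fst := sq.π_fst
        π_snd := sq.π_snd }
    obtain ⟨h₁, h₂⟩ := hS.pullbackPower _ _ (hadj.quillen.cofibration k hk) hp sq'
    exact ⟨h₁, fun h => h₂ (h.imp_left (hadj.quillen.weakEquivalence k hk))⟩
  isFibrant_cotensor w y hw hy :=
    hS.isFibrant_cotensor _ ((toBase adj C).obj y) (hadj.quillen.isCofibrant_obj hw) hy
  ψ_naturality_left w x x' f y := by
    rw [eHomWhiskerRight_changeOfEnrichment, eHomWhiskerRight_changeOfEnrichment]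
    exact map_comp_ihomComparison_naturality adj w (hS.ψ_naturality_left (F.obj w) f y)
  ψ_naturality_mid w w' g x y := by
    rw [eHomWhiskerLeft_changeOfEnrichment]
    exact map_comp_ihomComparison_naturality_mid adj g (hS.ψ_naturality_mid (F.map g) x y)
  ψ_naturality_right w x y y' h := by
    rw [eHomWhiskerLeft_changeOfEnrichment, eHomWhiskerLeft_changeOfEnrichment]
    exact map_comp_ihomComparison_naturality adj w (hS.ψ_naturality_right (F.obj w) x h)
  ψ_weakEquivalence w x y hw hx hy :=
    have hFw := hadj.quillen.isCofibrant_obj hw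
    weakEquivalence_map_comp_ihomComparison adj hV hW hadj.quillen hadj.tensor hw
      (hfib _ _ hx (hS.isFibrant_cotensor _ _ hFw hy)) (hfib _ _ hx hy)
      (hS.ψ_weakEquivalence _ _ _ hFw hx hy)
  η_naturality y y' h :=
    have h' {y y' : C} (h : y ⟶ y') :
        h ≫ S.η y' ≫ (S.cotensor.map (Functor.OplaxMonoidal.η F).op).app y' =
          (S.η y ≫ (S.cotensor.map (Functor.OplaxMonoidal.η F).op).app y) ≫
            (S.cotensor.obj (op (F.obj (𝟙_ W)))).map h := by
      rw [reassoc_of% hS.η_naturality h, Category.assoc, NatTrans.naturality]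
    h' ((toBase adj C).map h)
  η_ψ x y := by
    rw [eHomWhiskerLeft_changeOfEnrichment]
    refine map_comp_ihomComparison_unit adj (φ := S.ψ (F.obj (𝟙_ W)) _ ((toBase adj C).obj y)) ?_
    change eHomWhiskerLeft V _ (S.η ((toBase adj C).obj y) ≫ (S.cotensor.map (Functor.OplaxMonoidal.η F).op).app _) ≫
      _ = _
    rw [eHomWhiskerLeft_comp, Category.assoc, hS.ψ_naturality_mid, reassoc_of% hS.η_ψ]

omit [SymmetricCategory V] [SymmetricCategory W] [ModelCategory V] [ModelCategory W]
  [ModelCategory C]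

lemma IsSetCompatible.changeOfEnrichment (hS : S.IsSetCompatible) :
    (S.changeOfEnrichment adj).IsSetCompatible := fun w x y =>
  bijective_comp_map_comp_ihomComparison adj w
    (hS (F.obj w) ((toBase adj C).obj x) ((toBase adj C).obj y))

lemma IsUnital.changeOfEnrichment (hS : S.IsUnital) : (S.changeOfEnrichment adj).IsUnital :=
  fun y => by
    have h (y : C) : IsIso (S.η y ≫ (S.cotensor.map (Functor.OplaxMonoidal.η F).op).app y) :=
      have := hS y
      inferInstance
    exact h ((toBase adj C).obj y)

end CotensoringData

lemma IsWeakModelCategory.changeOfEnrichment {T : TensoringData V C} {S : CotensoringData V C}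
    (h : IsWeakModelCategory T S) (hV : IsMonoidalModelCategory V)
    (hW : IsMonoidalModelCategory W) (hadj : IsWeakMonoidalQuillenAdjunction adj) :
    IsWeakModelCategory (T.changeOfEnrichment adj) (S.changeOfEnrichment adj) where
  sm7 := h.sm7.changeOfEnrichment adj C hadj.quillen
  isFibrant_eHom _ _ hx hy := hadj.quillen.isFibrant_obj (h.isFibrant_eHom _ _ hx hy)
  weakTensoring := h.weakTensoring.changeOfEnrichment adj hV hW hadj h.isFibrant_eHom
  weakCotensoring := h.weakCotensoring.changeOfEnrichment adj hV hW hadj h.isFibrant_eHom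
  piZero := h.piZero.changeOfEnrichment adj C hadj h.isFibrant_eHom

end ChangeOfEnrichment

/-! ### Genuine tensorings and cotensorings -/

section Genuine

open MonoidalClosed

variable {V : Type u₁} [Category.{v₁} V] [MonoidalCategory V]
  {C : Type u₃} [Category.{v₃} C] [EnrichedOrdinaryCategory V C]

variable (V) in
lemma eHomEquiv_comp_eq_whiskerRight {x y z : C} (f : x ⟶ y) (g : y ⟶ z) :
    eHomEquiv V (f ≫ g) = eHomEquiv V g ≫ eHomWhiskerRight V f z := by
  rw [eHomEquiv_comp, eHomWhiskerRight, leftUnitor_inv_naturality_assoc, tensorHom_def'_assoc]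

variable (V) in
lemma eHomEquiv_comp_eq_whiskerLeft {x y z : C} (f : x ⟶ y) (g : y ⟶ z) :
    eHomEquiv V (f ≫ g) = eHomEquiv V f ≫ eHomWhiskerLeft V x g := by
  rw [eHomEquiv_comp, eHomWhiskerLeft, rightUnitor_inv_naturality_assoc, tensorHom_def_assoc,
    unitors_inv_equal]

variable (V) in
lemma eId_comp_eHomWhiskerRight {x y : C} (f : x ⟶ y) :
    eId V y ≫ eHomWhiskerRight V f y = eHomEquiv V f := by
  rw [← eHomEquiv_id, ← eHomEquiv_comp_eq_whiskerRight, Category.comp_id]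

variable (V) in
lemma eId_comp_eHomWhiskerLeft {x y : C} (f : x ⟶ y) :
    eId V x ≫ eHomWhiskerLeft V x f = eHomEquiv V f := by
  rw [← eHomEquiv_id, ← eHomEquiv_comp_eq_whiskerLeft, Category.id_comp]

variable [MonoidalClosed V]

lemma toUnitIHom_naturality {a b : V} (f : a ⟶ b) :
    toUnitIHom a ≫ (ihom (𝟙_ V)).map f = f ≫ toUnitIHom b := by
  rw [toUnitIHom, toUnitIHom, ← curry_natural_right, ← curry_natural_left, leftUnitor_naturality]

lemma whiskerLeft_toUnitIHom_comp_ev (a : V) :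
    𝟙_ V ◁ toUnitIHom a ≫ (ihom.ev (𝟙_ V)).app a = (λ_ a).hom := by
  rw [toUnitIHom, whiskerLeft_curry_ihom_ev_app]

instance (a : V) : IsIso (toUnitIHom a) := by
  refine ⟨(λ_ _).inv ≫ (ihom.ev (𝟙_ V)).app a, ?_, ?_⟩
  · rw [leftUnitor_inv_naturality_assoc, whiskerLeft_toUnitIHom_comp_ev, Iso.inv_hom_id]
  · rw [toUnitIHom, ← curry_natural_left, leftUnitor_naturality, curry_eq_iff, uncurry_id_eq_ev]
    exact Iso.hom_inv_id_assoc (λ_ _) _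

namespace Tensoring

variable (T : Tensoring V C)

lemma naturality_right (v : V) (x : C) {y y' : C} (h : y ⟶ y') :
    eHomWhiskerLeft V ((T.tensor.obj x).obj v) h ≫ (T.iso v x y').hom =
      (T.iso v x y).hom ≫ (ihom v).map (eHomWhiskerLeft V x h) := by
  rw [eHomWhiskerLeft, Category.assoc, Category.assoc, T.enriched_naturality,
    whisker_exchange_assoc, ← rightUnitor_inv_naturality_assoc]
  congr 1
  rw [← curry_natural_left, ← curry_natural_left, curry_eq_iff, uncurry_ihom_map, eHomWhiskerLeft]
  rw [associator_inv_naturality_right_assoc, whisker_exchange_assoc, whiskerLeft_rightUnitor_inv,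
    Category.assoc, Iso.hom_inv_id_assoc, ← rightUnitor_inv_naturality_assoc]
  rfl

/-- The map `x ⊗ 𝟙 ⟶ x`, written in terms of `T.tensor`; it is `T.toData.ρ x`. -/
def ρ (x : C) : (T.tensor.obj x).obj (𝟙_ V) ⟶ x := T.toData.ρ x

lemma eHomEquiv_ρ_comp_iso (x : C) :
    eHomEquiv V (T.ρ x) ≫ (T.iso (𝟙_ V) x x).hom = eId V x ≫ toUnitIHom (eHom V x x) := by
  have h : eHomEquiv V (T.ρ x) =
      eId V x ≫ toUnitIHom (eHom V x x) ≫ (T.iso (𝟙_ V) x x).inv :=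
    Equiv.apply_symm_apply _ _
  rw [h, Category.assoc, Category.assoc, Iso.inv_hom_id, Category.comp_id]

lemma eHomWhiskerRight_ρ_comp_iso (x y : C) :
    eHomWhiskerRight V (T.ρ x) y ≫ (T.iso (𝟙_ V) x y).hom = toUnitIHom (eHom V x y) := by
  rw [eHomWhiskerRight, Category.assoc, Category.assoc, T.enriched_naturality,
    ← comp_whiskerRight_assoc, T.eHomEquiv_ρ_comp_iso, ← curry_natural_left, ← curry_natural_left,
    toUnitIHom]
  congr 1
  rw [associator_inv_naturality_middle_assoc, ← comp_whiskerRight_assoc,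
    MonoidalCategory.whiskerLeft_comp_assoc, whiskerLeft_curry_ihom_ev_app]
  have h := e_id_comp V x y
  rw [Iso.inv_comp_eq, Category.comp_id] at h
  refine Eq.trans ?_ h
  simp

lemma ρ_naturality {x x' : C} (f : x ⟶ x') :
    (T.tensor.map f).app (𝟙_ V) ≫ T.ρ x' = T.ρ x ≫ f := by
  apply (eHomEquiv V).injective
  rw [← cancel_mono (T.iso (𝟙_ V) x x').hom, eHomEquiv_comp_eq_whiskerRight,
    eHomEquiv_comp_eq_whiskerRight, Category.assoc, Category.assoc,
    T.eHomWhiskerRight_ρ_comp_iso, T.naturality_left, ← Category.assoc, T.eHomEquiv_ρ_comp_iso,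
    Category.assoc, toUnitIHom_naturality, ← Category.assoc, eId_comp_eHomWhiskerRight]

lemma isSetCompatible_toData : T.toData.IsSetCompatible := fun v x y =>
  (T.iso v x y).homToEquiv.bijective

lemma isUnital_toData : T.toData.IsUnital := fun x => by
  change IsIso (T.ρ x)
  rw [isIso_iff_coyoneda_map_bijective]
  intro y
  have : IsIso (eHomWhiskerRight V (T.ρ x) y) := by
    have : IsIso (eHomWhiskerRight V (T.ρ x) y ≫ (T.iso (𝟙_ V) x y).hom) := by
      rw [T.eHomWhiskerRight_ρ_comp_iso]
      infer_instance
    exact IsIso.of_isIso_comp_right _ (T.iso (𝟙_ V) x y).hom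
  convert ((eHomEquiv V).trans ((asIso (eHomWhiskerRight V (T.ρ x) y)).homToEquiv.trans
    (eHomEquiv V).symm)).bijective using 2 with f
  exact (eHomEquiv V).injective (by simp [eHomEquiv_comp_eq_whiskerRight])

/-- The bijection `C(x ⊗ v, y) ≃ V(v, C(x, y))` on underlying sets. -/
def homEquiv (v : V) (x y : C) :
    ((T.tensor.obj x).obj v ⟶ y) ≃ (v ⟶ eHom V x y) :=
  (eHomEquiv V).trans <| (T.iso v x y).homToEquiv.trans <|
    ((ihom.adjunction v).homEquiv _ _).symm.trans (ρ_ v).homFromEquiv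

lemma homEquiv_apply {v : V} {x y : C} (f : (T.tensor.obj x).obj v ⟶ y) :
    T.homEquiv v x y f = (ρ_ v).inv ≫ uncurry (eHomEquiv V f ≫ (T.iso v x y).hom) := rfl

lemma homEquiv_naturality_one {v : V} {x x' y : C} (f : x ⟶ x')
    (g : (T.tensor.obj x').obj v ⟶ y) :
    T.homEquiv v x y ((T.tensor.map f).app v ≫ g) =
      T.homEquiv v x' y g ≫ eHomWhiskerRight V f y := by
  rw [homEquiv_apply, homEquiv_apply, eHomEquiv_comp_eq_whiskerRight, Category.assoc,
    T.naturality_left, Category.assoc, ← uncurry_natural_right, Category.assoc]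

lemma homEquiv_naturality_two {v v' : V} {x y : C} (f : v ⟶ v')
    (g : (T.tensor.obj x).obj v' ⟶ y) :
    T.homEquiv v x y ((T.tensor.obj x).map f ≫ g) = f ≫ T.homEquiv v' x y g := by
  rw [homEquiv_apply, homEquiv_apply, eHomEquiv_comp_eq_whiskerRight, Category.assoc,
    T.naturality_mid, ← Category.assoc, uncurry_pre_app, rightUnitor_inv_naturality_assoc]

lemma homEquiv_naturality_three {v : V} {x y y' : C} (f : (T.tensor.obj x).obj v ⟶ y)
    (g : y ⟶ y') :
    T.homEquiv v x y' (f ≫ g) = T.homEquiv v x y f ≫ eHomWhiskerLeft V x g := by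
  rw [homEquiv_apply, homEquiv_apply, eHomEquiv_comp_eq_whiskerLeft, Category.assoc,
    T.naturality_right, Category.assoc, ← uncurry_natural_right, Category.assoc]

/-- The adjunction between `x ⊗ -` and `C(x, -)`. -/
def adjunction (x : C) : T.tensor.obj x ⊣ (eHomFunctor V C).obj (op x) :=
  Adjunction.mkOfHomEquiv
    { homEquiv := fun v y => T.homEquiv v x y
      homEquiv_naturality_left_symm := fun f g => (T.homEquiv _ x _).injective <| by
        rw [T.homEquiv_naturality_two]
        erw [Equiv.apply_symm_apply, Equiv.apply_symm_apply]
        rfl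
      homEquiv_naturality_right := fun f g => T.homEquiv_naturality_three f g }

/-- The adjunction between `x ⊗ -` and `C(x, -)`, with parameter `x`. -/
def adjunction₂ : T.tensor ⊣₂ eHomFunctor V C :=
  .mk' T.adjunction fun f v y g => by
    simpa [adjunction] using! T.homEquiv_naturality_one f g

lemma adjunction_homEquiv_ρ_comp {x y : C} (f : x ⟶ y) :
    (T.adjunction x).homEquiv _ _ (T.ρ x ≫ f) = eHomEquiv V f := by
  rw [adjunction, Adjunction.mkOfHomEquiv_homEquiv]
  change T.homEquiv _ _ _ _ = _
  rw [homEquiv_apply, eHomEquiv_comp_eq_whiskerRight,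
    Category.assoc, T.eHomWhiskerRight_ρ_comp_iso, toUnitIHom, ← curry_natural_left, uncurry_curry,
    leftUnitor_naturality, unitors_equal, Iso.inv_hom_id_assoc]

end Tensoring

namespace Cotensoring

variable [BraidedCategory V] (S : Cotensoring V C)

lemma naturality_left (v : V) {x x' : C} (f : x ⟶ x') (y : C) :
    eHomWhiskerRight V f ((S.cotensor.obj (op v)).obj y) ≫ (S.iso v x y).hom =
      (S.iso v x' y).hom ≫ (ihom v).map (eHomWhiskerRight V f y) := by
  rw [eHomWhiskerRight, Category.assoc, Category.assoc, S.enriched_naturality,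
    ← whisker_exchange_assoc, ← leftUnitor_inv_naturality_assoc]
  congr 1
  rw [← curry_natural_left, ← curry_natural_left, curry_eq_iff, uncurry_ihom_map, eHomWhiskerRight,
    associator_inv_naturality_middle_assoc, ← comp_whiskerRight_assoc,
    BraidedCategory.braiding_naturality_right, comp_whiskerRight_assoc,
    associator_naturality_left_assoc, ← whisker_exchange_assoc, braiding_tensorUnit_right]
  simp

/-- The map `y ⟶ y ^ 𝟙`, written in terms of `S.cotensor`; it is `S.toData.η y`. -/
def η (y : C) : y ⟶ (S.cotensor.obj (op (𝟙_ V))).obj y := S.toData.η y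

lemma eHomEquiv_η_comp_iso (y : C) :
    eHomEquiv V (S.η y) ≫ (S.iso (𝟙_ V) y y).hom = eId V y ≫ toUnitIHom (eHom V y y) := by
  have h : eHomEquiv V (S.η y) =
      eId V y ≫ toUnitIHom (eHom V y y) ≫ (S.iso (𝟙_ V) y y).inv :=
    Equiv.apply_symm_apply _ _
  rw [h, Category.assoc, Category.assoc, Iso.inv_hom_id, Category.comp_id]

lemma eHomWhiskerLeft_η_comp_iso (x y : C) :
    eHomWhiskerLeft V x (S.η y) ≫ (S.iso (𝟙_ V) x y).hom = toUnitIHom (eHom V x y) := by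
  rw [eHomWhiskerLeft, Category.assoc, Category.assoc, S.enriched_naturality,
    ← MonoidalCategory.whiskerLeft_comp_assoc, S.eHomEquiv_η_comp_iso, ← curry_natural_left,
    ← curry_natural_left, toUnitIHom]
  congr 1
  rw [associator_inv_naturality_right_assoc, whisker_exchange_assoc,
    associator_naturality_right_assoc, ← MonoidalCategory.whiskerLeft_comp_assoc,
    MonoidalCategory.whiskerLeft_comp_assoc (𝟙_ V), whiskerLeft_curry_ihom_ev_app,
    braiding_tensorUnit_left]
  rw [← cancel_epi (λ_ (eHom V x y)).inv, Iso.inv_hom_id, ← e_comp_id V x y]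
  simp

lemma η_naturality {y y' : C} (h : y ⟶ y') :
    h ≫ S.η y' = S.η y ≫ (S.cotensor.obj (op (𝟙_ V))).map h := by
  apply (eHomEquiv V).injective
  rw [← cancel_mono (S.iso (𝟙_ V) y y').hom, eHomEquiv_comp_eq_whiskerLeft,
    eHomEquiv_comp_eq_whiskerLeft, Category.assoc, Category.assoc,
    S.eHomWhiskerLeft_η_comp_iso, S.naturality_right, ← Category.assoc (eHomEquiv V (S.η y)),
    S.eHomEquiv_η_comp_iso, Category.assoc, toUnitIHom_naturality, ← Category.assoc,
    eId_comp_eHomWhiskerLeft]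

lemma isSetCompatible_toData : S.toData.IsSetCompatible := fun v x y =>
  (S.iso v x y).homToEquiv.bijective

lemma isUnital_toData : S.toData.IsUnital := fun y => by
  change IsIso (S.η y)
  rw [isIso_iff_yoneda_map_bijective]
  intro x
  have : IsIso (eHomWhiskerLeft V x (S.η y)) := by
    have : IsIso (eHomWhiskerLeft V x (S.η y) ≫ (S.iso (𝟙_ V) x y).hom) := by
      rw [S.eHomWhiskerLeft_η_comp_iso]
      infer_instance
    exact IsIso.of_isIso_comp_right _ (S.iso (𝟙_ V) x y).hom
  convert ((eHomEquiv V).trans ((asIso (eHomWhiskerLeft V x (S.η y))).homToEquiv.trans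
    (eHomEquiv V).symm)).bijective using 2 with f
  exact (eHomEquiv V).injective (by simp [eHomEquiv_comp_eq_whiskerLeft])

variable (T : Tensoring V C)

/-- The bijection `C(x ⊗ v, y) ≃ C(x, y ^ v)` on underlying sets. -/
def homEquiv (v : V) (x y : C) :
    ((T.tensor.obj x).obj v ⟶ y) ≃ (x ⟶ (S.cotensor.obj (op v)).obj y) :=
  (eHomEquiv V).trans <| (T.iso v x y ≪≫ (S.iso v x y).symm).homToEquiv.trans (eHomEquiv V).symm

lemma eHomEquiv_homEquiv_comp_iso {v : V} {x y : C} (f : (T.tensor.obj x).obj v ⟶ y) :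
    eHomEquiv V (S.homEquiv T v x y f) ≫ (S.iso v x y).hom =
      eHomEquiv V f ≫ (T.iso v x y).hom := by
  simp [homEquiv]

lemma homEquiv_eq_iff {v : V} {x y : C} (f : (T.tensor.obj x).obj v ⟶ y)
    (g : x ⟶ (S.cotensor.obj (op v)).obj y) :
    S.homEquiv T v x y f = g ↔
      eHomEquiv V f ≫ (T.iso v x y).hom = eHomEquiv V g ≫ (S.iso v x y).hom := by
  rw [← eHomEquiv_homEquiv_comp_iso S, cancel_mono, EmbeddingLike.apply_eq_iff_eq]

lemma homEquiv_naturality_one {v v' : V} {x y : C} (f : v ⟶ v')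
    (g : (T.tensor.obj x).obj v' ⟶ y) :
    S.homEquiv T v x y ((T.tensor.obj x).map f ≫ g) =
      S.homEquiv T v' x y g ≫ (S.cotensor.map f.op).app y := by
  rw [homEquiv_eq_iff, eHomEquiv_comp_eq_whiskerRight, eHomEquiv_comp_eq_whiskerLeft,
    Category.assoc, Category.assoc, S.naturality_mid, T.naturality_mid, ← Category.assoc,
    ← Category.assoc, eHomEquiv_homEquiv_comp_iso]

lemma homEquiv_naturality_two {v : V} {x x' y : C} (f : x ⟶ x')
    (g : (T.tensor.obj x').obj v ⟶ y) :
    S.homEquiv T v x y ((T.tensor.map f).app v ≫ g) = f ≫ S.homEquiv T v x' y g := by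
  rw [homEquiv_eq_iff, eHomEquiv_comp_eq_whiskerRight, eHomEquiv_comp_eq_whiskerRight,
    Category.assoc, Category.assoc, S.naturality_left, T.naturality_left, ← Category.assoc,
    ← Category.assoc, eHomEquiv_homEquiv_comp_iso]

lemma homEquiv_naturality_three {v : V} {x y y' : C} (f : (T.tensor.obj x).obj v ⟶ y)
    (g : y ⟶ y') :
    S.homEquiv T v x y' (f ≫ g) = S.homEquiv T v x y f ≫ (S.cotensor.obj (op v)).map g := by
  rw [homEquiv_eq_iff, eHomEquiv_comp_eq_whiskerLeft, eHomEquiv_comp_eq_whiskerLeft,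
    Category.assoc, Category.assoc, S.naturality_right, T.naturality_right, ← Category.assoc,
    ← Category.assoc, eHomEquiv_homEquiv_comp_iso]

/-- The adjunction between `- ⊗ v` and `- ^ v`. -/
def adjunction (v : V) : T.tensor.flip.obj v ⊣ S.cotensor.obj (op v) :=
  Adjunction.mkOfHomEquiv
    { homEquiv := fun x y => S.homEquiv T v x y
      homEquiv_naturality_left_symm := fun f g => (S.homEquiv T v _ _).injective <| by
        rw [Equiv.apply_symm_apply]
        exact ((S.homEquiv_naturality_two T f _).trans (by rw [Equiv.apply_symm_apply])).symm
      homEquiv_naturality_right := fun f g => S.homEquiv_naturality_three T f g }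

/-- The adjunction between `- ⊗ v` and `- ^ v`, with parameter `v`. -/
def adjunction₂ : T.tensor.flip ⊣₂ S.cotensor :=
  .mk' (S.adjunction T) fun f x y g => by
    simpa [adjunction] using! S.homEquiv_naturality_one T f g

end Cotensoring

variable [SymmetricCategory V] [ModelCategory V] [ModelCategory C]
  {T : Tensoring V C} {S : Cotensoring V C}

namespace IsGenuineModelCategory

variable (h : IsGenuineModelCategory T S)
include h

lemma isQuillenAdjunction {x : C} (hx : IsCofibrant x) : IsQuillenAdjunction (T.adjunction x) := by
  have (v : V) := (S.adjunction T v).leftAdjoint_preservesColimits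
  exact h.pushoutProduct.isQuillenAdjunction hx _

lemma isQuillenAdjunction_flip {v : V} (hv : IsCofibrant v) :
    IsQuillenAdjunction (S.adjunction T v) := by
  have (x : C) : PreservesColimits (T.tensor.flip.flip.obj x) :=
    (T.adjunction x).leftAdjoint_preservesColimits
  exact h.pushoutProduct.flip.isQuillenAdjunction hv _

lemma isWeakTensoring : T.toData.IsWeakTensoring where
  pushoutProduct := h.pushoutProduct
  isCofibrant_tensor _ _ hx hv := (h.isQuillenAdjunction hx).isCofibrant_obj hv
  φ_naturality_left := T.naturality_left
  φ_naturality_mid _ _ g := T.naturality_mid g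
  φ_naturality_right := T.naturality_right
  φ_weakEquivalence v x y _ _ _ := inferInstanceAs (WeakEquivalence (T.iso v x y).hom)
  ρ_naturality _ _ f := T.ρ_naturality f
  ρ_φ := T.eHomWhiskerRight_ρ_comp_iso

lemma isWeakCotensoring : S.toData.IsWeakCotensoring where
  pullbackPower := h.pushoutProduct.flip.pullbackPowerAxiom (S.adjunction₂ T)
  isFibrant_cotensor _ _ hv hy := (h.isQuillenAdjunction_flip hv).isFibrant_obj hy
  ψ_naturality_left := S.naturality_left
  ψ_naturality_mid _ _ g := S.naturality_mid g
  ψ_naturality_right := S.naturality_right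
  ψ_weakEquivalence v x y _ _ _ := inferInstanceAs (WeakEquivalence (S.iso v x y).hom)
  η_naturality _ _ f := S.η_naturality f
  η_ψ := S.eHomWhiskerLeft_η_comp_iso

lemma piZeroAxiom : PiZeroAxiom V C := fun x y hx hy => by
  obtain ⟨Q, hQ, q, _, hq⟩ := CofibrantObject.HoCat.exists_resolution (𝟙_ V)
  obtain ⟨Θ, hΘ⟩ := (h.isQuillenAdjunction hx).exists_derivedHomEquiv_of_isCofibrantReplacement
    (p := T.ρ x) ⟨hQ, hq⟩ (h.unit x hx q ⟨hQ, hq⟩) hy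
  exact ⟨Θ, Θ.bijective, fun f => (hΘ f).trans (by rw [T.adjunction_homEquiv_ρ_comp]; rfl)⟩

lemma isWeakModelCategory : IsWeakModelCategory T.toData S.toData where
  sm7 := h.pushoutProduct.pullbackPowerAxiom T.adjunction₂
  isFibrant_eHom _ _ hx hy := (h.isQuillenAdjunction hx).isFibrant_obj hy
  weakTensoring := h.isWeakTensoring
  weakCotensoring := h.isWeakCotensoring
  piZero := h.piZeroAxiom

end IsGenuineModelCategory

end Genuine

end WeakEnriched

end

open WeakEnriched in
theorem theorem7p2
    {V : Type u₁} [Category.{v₁} V] [MonoidalCategory V] [SymmetricCategory V]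
    [MonoidalClosed V] [ModelCategory V] (hV : IsMonoidalModelCategory V)
    {W : Type u₂} [Category.{v₂} W] [MonoidalCategory W] [SymmetricCategory W]
    [MonoidalClosed W] [ModelCategory W] (hW : IsMonoidalModelCategory W)
    {F : W ⥤ V} {G : V ⥤ W} (adj : F ⊣ G)
    [F.OplaxMonoidal] [G.LaxMonoidal] [adj.IsMonoidal]
    (hadj : IsWeakMonoidalQuillenAdjunction adj)
    [IsIso (Functor.OplaxMonoidal.η F)]
    {C : Type u₃} [Category.{v₃} C] [EnrichedOrdinaryCategory V C] [ModelCategory C] :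
    (∀ (T : TensoringData V C) (S : CotensoringData V C), IsWeakModelCategory T S →
      IsWeakModelCategory (T.changeOfEnrichment adj) (S.changeOfEnrichment adj) ∧
      (T.IsSetCompatible → (T.changeOfEnrichment adj).IsSetCompatible) ∧
      (T.IsUnital → (T.changeOfEnrichment adj).IsUnital) ∧
      (S.IsSetCompatible → (S.changeOfEnrichment adj).IsSetCompatible) ∧
      (S.IsUnital → (S.changeOfEnrichment adj).IsUnital)) ∧
    (∀ (T : Tensoring V C) (S : Cotensoring V C), IsGenuineModelCategory T S →
      (IsWeakModelCategory T.toData S.toData ∧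
        T.toData.IsSetCompatible ∧ T.toData.IsUnital ∧
        S.toData.IsSetCompatible ∧ S.toData.IsUnital) ∧
      (IsWeakModelCategory (T.toData.changeOfEnrichment adj) (S.toData.changeOfEnrichment adj) ∧
        (T.toData.changeOfEnrichment adj).IsSetCompatible ∧
        (T.toData.changeOfEnrichment adj).IsUnital ∧
        (S.toData.changeOfEnrichment adj).IsSetCompatible ∧
        (S.toData.changeOfEnrichment adj).IsUnital)) := by
  refine ⟨fun T S h => ⟨h.changeOfEnrichment adj hV hW hadj,
    fun hT => hT.changeOfEnrichment adj, fun hT => hT.changeOfEnrichment adj,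
    fun hS => hS.changeOfEnrichment adj, fun hS => hS.changeOfEnrichment adj⟩,
    fun T S h => ⟨⟨h.isWeakModelCategory, T.isSetCompatible_toData, T.isUnital_toData,
      S.isSetCompatible_toData, S.isUnital_toData⟩,
      h.isWeakModelCategory.changeOfEnrichment adj hV hW hadj,
      T.isSetCompatible_toData.changeOfEnrichment adj, T.isUnital_toData.changeOfEnrichment adj,
      S.isSetCompatible_toData.changeOfEnrichment adj, S.isUnital_toData.changeOfEnrichment adj⟩⟩
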